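/- **Theorem 4.6.** Let $\mathcal H=L^2(\mathbb R)$ and, for $x,y\in\mathbb R$, $|z|=1$, let $\rho(x,y,z)$ be the unitary operator $(\rho(x,y,z)\varphi)(t)=z\,e^{\pi i(xy+2yt)}\varphi(t+x)$ on $\mathcal H$; write $\rho(w,1)=\rho(x,y,1)$ for $w=(x,y)$. Let $a\ge 1$ be an integer, $N=\mathbb Z\times a\mathbb Z$, and $N^\perp=\{w\in\mathbb R^2 : e(n,w)=1\ \forall n\in N\}$, where $e((x,y),(x',y'))=e^{2\pi i(xy'-yx')}$. A (possibly unbounded) operator $T$ is $N$-periodic if $\rho(n,1)T\rho(n,1)^{-1}=T$ for all $n\in N$; let $\mathcal A_N$ be the von Neumann algebra of bounded $N$-periodic operators, with the faithful finite trace $\tau(T)=\sum_{h=0}^{a-1}\langle T\chi_h,\chi_h\rangle$, $\chi_h=\chi_{[h/a,(h+1)/a)}$. Let $L^1(\mathcal A_N,\tau)$ be the space of closed, densely defined, $N$-periodic operators $T$ with $\|T\|_1=\tau(|T|)=\int_0^\infty\tau(\chi_{(t,\infty)}(|T|))\,dt<\infty$, and extend $\tau$ to $L^1(\mathcal A_N,\tau)$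 by $\|\cdot\|_1$-continuity. Sums of elements of $L^1(\mathcal A_N,\tau)$ are closures of the algebraic sums. Let $\Omega=[0,1)\times[0,1)$ and let $Z:\mathcal H\to L^2(\Omega)$ be the (unitary) Zak transform $(Z\varphi)(\theta,\sigma)=\sum_{l\in\mathbb Z}\varphi(\sigma-l)e^{2\pi i l\theta}$, with $Z\varphi$ extended to $\mathbb R^2$ by $(Z\varphi)(\theta+1,\sigma)=(Z\varphi)(\theta,\sigma)$ and $(Z\varphi)(\theta,\sigma+1)=e^{2\pi i\theta}(Z\varphi)(\theta,\sigma)$. For measurable $g$ let $M_g\varphi=Z^{-1}(gZ\varphi)$ on $\{\varphi\in\mathcal H: gZ\varphi\in L^2(\Omega)\}$. For $\varphi,\psi\in\mathcal H$ let $(\varphi\otimes\bar\psi)f=\langle f,\psi\rangle\varphi$ and $$\widetilde{\varphi\otimes\bar\psi}=\sum_{j=0}^{a-1}M_{g_j}\,\rho(-j/a,0,1),\qquad g_j(\theta,\sigma)=(Z\varphi)(\theta,\sigma)\,\overline{(Z\psi)(\theta,\sigma-j/a)}.$$ If $X=\sum_{i=1}^n\varphi_i\otimes\bar\psi_i$ is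 a finite rank operator on $\mathcal H$, put $\widetilde X=\sum_{i=1}^n\widetilde{\varphi_i\otimes\bar\psi_i}$. Then, for every finite rank operator $X\in\mathcal B(\mathcal H)$, the operator $\widetilde X$ does not depend on the chosen representation of $X$, it belongs to $L^1(\mathcal A_N,\tau)$, and $$\tau\big(\widetilde X\,\rho(n',1)^*\big)=\alpha(X)(n')\qquad\text{for all } n'\in N^\perp,$$ where $\alpha(X)(w)=\operatorname{tr}\big(X\rho(w,1)^*\big)$. -/

import Mathlib

noncomputable section

namespace ZakPeriodization

open MeasureTheory Set Filter
open scoped ENNReal InnerProductSpace ComplexConjugate Topology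

/-- The Hilbert space `L²(ℝ)`. -/
abbrev H : Type := Lp ℂ 2 (volume : Measure ℝ)

/-- `e(t) = exp(2πit)`. -/
def phase (t : ℝ) : ℂ := Complex.exp (2 * Real.pi * Complex.I * t)

lemma phase_add (s t : ℝ) : phase (s + t) = phase s * phase t := by
  simp only [phase]; rw [← Complex.exp_add]; congr 1; push_cast; ring

@[simp] lemma phase_zero : phase 0 = 1 := by simp [phase]

@[simp] lemma norm_phase (t : ℝ) : ‖phase t‖ = 1 := by
  have : phase t = Complex.exp ((2 * Real.pi * t : ℝ) * Complex.I) := by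
    simp only [phase]; congr 1; push_cast; ring
  rw [this, Complex.norm_exp_ofReal_mul_I]

lemma continuous_phase : Continuous phase := by unfold phase; fun_prop

lemma memLp_phase_mul {α : Type*} [MeasurableSpace α] {μ : Measure α} {u : α → ℝ}
    (hu : Measurable u) {f : α → ℂ} (hf : MemLp f 2 μ) :
    MemLp (fun s => phase (u s) * f s) 2 μ := by
  refine hf.of_le ?_ (ae_of_all _ fun s => by simp)
  exact (continuous_phase.measurable.comp hu).aestronglyMeasurable.mul hf.1

/-- `z exp(πi(xy + 2yt)) f(t + x)`. -/
def rhoFun (x y : ℝ) (z : Circle) (f : ℝ → ℂ) (t : ℝ) : ℂ :=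
  z * phase (x * y / 2 + y * t) * f (t + x)

lemma memLp_rhoFun (x y : ℝ) (z : Circle) (φ : H) : MemLp (rhoFun x y z φ) 2 volume := by
  have h1 : MemLp (fun t => φ (t + x)) 2 (volume : Measure ℝ) :=
    (Lp.memLp φ).comp_measurePreserving (measurePreserving_add_right volume x)
  have h2 := (memLp_phase_mul (u := fun t => x * y / 2 + y * t) (by fun_prop) h1).const_mul (z : ℂ)
  convert h2 using 2
  simp [rhoFun, mul_assoc]

lemma ae_shift {p : ℝ → Prop} (x : ℝ) (h : ∀ᵐ t, p t) : ∀ᵐ t, p (t + x) :=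
  (measurePreserving_add_right volume x).quasiMeasurePreserving.ae h

/-- The linear map underlying `ρ(x,y,z)`. -/
def rhoLin (x y : ℝ) (z : Circle) : H →ₗ[ℂ] H where
  toFun φ := (memLp_rhoFun x y z φ).toLp
  map_add' φ ψ := by
    rw [← MemLp.toLp_add]
    refine MemLp.toLp_congr _ _ ?_
    filter_upwards [ae_shift x (Lp.coeFn_add φ ψ)] with t ht
    rw [Pi.add_apply] at ht
    simp only [rhoFun, ht, mul_add, Pi.add_apply]
  map_smul' c φ := by
    rw [RingHom.id_apply, ← MemLp.toLp_const_smul]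
    refine MemLp.toLp_congr _ _ ?_
    filter_upwards [ae_shift x (Lp.coeFn_smul c φ)] with t ht
    rw [Pi.smul_apply] at ht
    simp only [rhoFun, ht, Pi.smul_apply, smul_eq_mul]; ring

lemma rhoLin_coeFn (x y : ℝ) (z : Circle) (φ : H) :
    rhoLin x y z φ =ᵐ[volume] rhoFun x y z φ := MemLp.coeFn_toLp (memLp_rhoFun x y z φ)

lemma rhoLin_neg (x y : ℝ) (z : Circle) (φ : H) :
    rhoLin (-x) (-y) z⁻¹ (rhoLin x y z φ) = φ := by
  refine Lp.ext ?_
  filter_upwards [rhoLin_coeFn (-x) (-y) z⁻¹ (rhoLin x y z φ),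
    ae_shift (-x) (rhoLin_coeFn x y z φ)] with t h1 h2
  rw [h1, rhoFun, h2, rhoFun]
  have hz : ((z⁻¹ : Circle) : ℂ) * z = 1 := by rw [← Circle.coe_mul]; simp
  have hp : phase (-x * -y / 2 + -y * t) * phase (x * y / 2 + y * (t + -x)) = 1 := by
    rw [← phase_add, ← phase_zero]; congr 1; ring
  have : t + -x + x = t := by ring
  rw [this]
  linear_combination (phase (-x * -y / 2 + -y * t) * phase (x * y / 2 + y * (t + -x)) * φ t) * hz
    + φ t * hp

lemma norm_rhoLin (x y : ℝ) (z : Circle) (φ : H) : ‖rhoLin x y z φ‖ = ‖φ‖ := by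
  rw [Lp.norm_def, Lp.norm_def, eLpNorm_congr_ae (rhoLin_coeFn x y z φ)]
  have h1 : eLpNorm (rhoFun x y z φ) 2 volume = eLpNorm (fun t => φ (t + x)) 2 volume := by
    refine eLpNorm_congr_norm_ae (ae_of_all _ fun t => ?_)
    simp [rhoFun, Circle.norm_coe]
  rw [h1]
  congr 1
  exact eLpNorm_comp_measurePreserving (Lp.memLp φ).1 (measurePreserving_add_right volume x)

/-- The Schrödinger representation of the Heisenberg group on `L²(ℝ)`:
`(ρ(x,y,z)φ)(t) = z exp(πi(xy + 2yt)) φ(t + x)`. -/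
def rho (x y : ℝ) (z : Circle) : H ≃ₗᵢ[ℂ] H where
  toLinearEquiv := LinearEquiv.ofLinearMap (rhoLin x y z) (rhoLin (-x) (-y) z⁻¹)
    (by ext1 φ; simpa using rhoLin_neg (-x) (-y) z⁻¹ φ)
    (by ext1 φ; exact rhoLin_neg x y z φ)
  norm_map' := norm_rhoLin x y z

/-- The unit square `[0,1) × [0,1)`, with coordinates `(θ, σ)`. -/
def Ω : Set (ℝ × ℝ) := Ico 0 1 ×ˢ Ico 0 1

lemma vol_Ω : (volume.restrict Ω : Measure (ℝ × ℝ)) =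
    (volume.restrict (Ico (0:ℝ) 1)).prod (volume.restrict (Ico (0:ℝ) 1)) := by
  rw [Ω, Measure.volume_eq_prod, Measure.prod_restrict]

lemma integrable_prod_of_Ω {E : Type*} [NormedAddCommGroup E] {f : ℝ × ℝ → E}
    (h : Integrable f (volume.restrict Ω)) :
    Integrable f ((volume.restrict (Ico (0:ℝ) 1)).prod (volume.restrict (Ico (0:ℝ) 1))) := by
  rwa [vol_Ω] at h

lemma integral_Ω (f : ℝ × ℝ → ℂ) : ∫ w in Ω, f w =
    ∫ w, f w ∂((volume.restrict (Ico (0:ℝ) 1)).prod (volume.restrict (Ico (0:ℝ) 1))) := by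
  rw [vol_Ω]

lemma ae_Ω_iff {p : ℝ × ℝ → Prop} : (∀ᵐ w ∂(volume.restrict Ω : Measure (ℝ × ℝ)), p w) ↔
    ∀ᵐ w ∂((volume.restrict (Ico (0:ℝ) 1)).prod (volume.restrict (Ico (0:ℝ) 1))), p w := by
  rw [vol_Ω]

instance : IsProbabilityMeasure (volume.restrict (Ico (0:ℝ) 1)) := ⟨by simp⟩

instance : IsProbabilityMeasure (volume.restrict Ω : Measure (ℝ × ℝ)) := by
  rw [vol_Ω]; infer_instance

/-- The Hilbert space `L²(Ω)`. -/
abbrev L2Ω : Type := Lp ℂ 2 (volume.restrict Ω)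

/-- `exp(2πilθ) f(σ - l)` as a function of `(θ, σ)`. -/
def zakTermFun (l : ℤ) (f : ℝ → ℂ) (w : ℝ × ℝ) : ℂ := phase (l * w.1) * f (w.2 - l)

lemma memLp_zakTermFun (l : ℤ) (φ : H) : MemLp (zakTermFun l φ) 2 (volume.restrict Ω) := by
  refine memLp_phase_mul (u := fun w : ℝ × ℝ => l * w.1) (by fun_prop) ?_
  rw [vol_Ω]
  have h1 : MemLp (fun t => φ (t - l)) 2 (volume : Measure ℝ) :=
    (Lp.memLp φ).comp_measurePreserving (measurePreserving_sub_right volume (l : ℝ))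
  exact (h1.restrict (Ico 0 1)).comp_snd _

lemma ae_Ω_of_ae {p : ℝ → Prop} (h : ∀ᵐ t, p t) (l : ℤ) :
    ∀ᵐ w ∂(volume.restrict Ω : Measure (ℝ × ℝ)), p (w.2 - l) := by
  rw [vol_Ω]
  refine Measure.quasiMeasurePreserving_snd.ae (p := fun t => p (t - l)) ?_
  exact ae_restrict_of_ae ((measurePreserving_sub_right volume (l : ℝ)).quasiMeasurePreserving.ae h)

/-- The `l`-th term of the Zak series, as a linear map `L²(ℝ) → L²(Ω)`. -/
def zakTerm (l : ℤ) : H →ₗ[ℂ] L2Ω where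
  toFun φ := (memLp_zakTermFun l φ).toLp
  map_add' φ ψ := by
    rw [← MemLp.toLp_add]
    refine MemLp.toLp_congr _ _ ?_
    filter_upwards [ae_Ω_of_ae (Lp.coeFn_add φ ψ) l] with t ht
    rw [Pi.add_apply] at ht
    simp only [zakTermFun, ht, mul_add, Pi.add_apply]
  map_smul' c φ := by
    rw [RingHom.id_apply, ← MemLp.toLp_const_smul]
    refine MemLp.toLp_congr _ _ ?_
    filter_upwards [ae_Ω_of_ae (Lp.coeFn_smul c φ) l] with t ht
    rw [Pi.smul_apply] at ht
    simp only [zakTermFun, ht, Pi.smul_apply, smul_eq_mul]; ring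

lemma zakTerm_coeFn (l : ℤ) (φ : H) :
    zakTerm l φ =ᵐ[volume.restrict Ω] zakTermFun l φ := MemLp.coeFn_toLp (memLp_zakTermFun l φ)

lemma integral_phase (n : ℤ) : ∫ t in Ico (0:ℝ) 1, phase (n * t) = if n = 0 then 1 else 0 := by
  split_ifs with h
  · simp [h]
  · rw [integral_Ico_eq_integral_Ioc, ← intervalIntegral.integral_of_le zero_le_one]
    have hc : (2 * Real.pi * Complex.I * n : ℂ) ≠ 0 := by
      simp [h, Real.pi_ne_zero]
    have := integral_exp_mul_complex (a := 0) (b := 1) hc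
    have h2 : ∀ t : ℝ, phase (n * t) = Complex.exp (2 * Real.pi * Complex.I * n * t) := by
      intro t; simp only [phase]; congr 1; push_cast; ring
    simp_rw [h2, this]
    have h3 : Complex.exp (2 * Real.pi * Complex.I * n) = 1 := by
      rw [mul_comm]; exact Complex.exp_int_mul_two_pi_mul_I n
    simp [h3]

lemma conj_phase (t : ℝ) : conj (phase t) = phase (-t) := by
  simp only [phase]; rw [← Complex.exp_conj]; simp [Complex.conj_ofNat]

lemma inner_zakTerm (l k : ℤ) (φ ψ : H) : ⟪zakTerm l φ, zakTerm k ψ⟫_ℂ =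
    if l = k then ∫ t in Ico (0:ℝ) 1, ⟪φ (t - l), ψ (t - l)⟫_ℂ else 0 := by
  rw [L2.inner_def]
  have h1 : ∫ w in Ω, ⟪zakTerm l φ w, zakTerm k ψ w⟫_ℂ =
      ∫ w in Ω, phase (((k - l : ℤ) : ℝ) * w.1) * ⟪φ (w.2 - l), ψ (w.2 - k)⟫_ℂ := by
    refine integral_congr_ae ?_
    filter_upwards [zakTerm_coeFn l φ, zakTerm_coeFn k ψ] with w h h'
    rw [h, h']
    have : phase (((k - l : ℤ) : ℝ) * w.1) = phase (k * w.1) * conj (phase (l * w.1)) := by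
      rw [conj_phase, ← phase_add]; congr 1; push_cast; ring
    rw [this]
    simp [zakTermFun]; ring
  rw [h1, vol_Ω, integral_prod_mul (fun θ => phase (((k - l : ℤ) : ℝ) * θ))
    (fun s => ⟪φ (s - l), ψ (s - k)⟫_ℂ), integral_phase]
  by_cases h : l = k
  · subst h; simp
  · have : ¬ (k - l = 0) := by omega
    simp [h, this]

lemma hasSum_cells {f : ℝ → ℂ} (hf : Integrable f) :
    HasSum (fun l : ℤ => ∫ t in Ico (0:ℝ) 1, f (t - l)) (∫ t, f t) := by
  have h := hasSum_integral_iUnion (μ := volume) (f := f) (s := fun n : ℤ => Ico (n : ℝ) (n + 1))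
    (fun _ => measurableSet_Ico) (pairwise_disjoint_Ico_intCast ℝ)
    (by rw [iUnion_Ico_intCast]; exact hf.integrableOn)
  rw [iUnion_Ico_intCast, Measure.restrict_univ] at h
  rw [← (Equiv.neg ℤ).hasSum_iff] at h
  have key : ∀ l : ℤ, ∫ t in Ico (0:ℝ) 1, f (t - l) =
      ∫ t in Ico (((-l : ℤ) : ℝ)) ((-l : ℤ) + 1), f t := by
    intro l
    have := (measurePreserving_sub_right (volume : Measure ℝ) (l : ℝ)).setIntegral_preimage_emb
      (MeasurableEquiv.subRight (l : ℝ)).measurableEmbedding f (Ico (((-l : ℤ) : ℝ)) ((-l : ℤ) + 1))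
    rw [← this]
    congr 2
    ext t; simp only [mem_Ico, mem_preimage, Int.cast_neg]
    constructor <;> rintro ⟨h1, h2⟩ <;> constructor <;> linarith
  simp_rw [key]
  exact h

lemma hasSum_norm_sq_zakTerm (φ : H) : HasSum (fun l => ‖zakTerm l φ‖ ^ 2) (‖φ‖ ^ 2) := by
  have h := hasSum_cells (L2.integrable_inner (𝕜 := ℂ) φ φ)
  rw [← L2.inner_def] at h
  have h2 := (Complex.reCLM.hasSum h)
  convert h2 using 1
  · ext l
    have := inner_zakTerm l l φ φ
    rw [if_pos rfl] at this
    simp only [Complex.reCLM_apply]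
    rw [← this]
    exact (inner_self_eq_norm_sq (𝕜 := ℂ) (zakTerm l φ)).symm
  · exact (inner_self_eq_norm_sq (𝕜 := ℂ) φ).symm

lemma summable_zakTerm (φ : H) : Summable fun l => zakTerm l φ := by
  have hV : OrthogonalFamily ℂ (fun l => (ℂ ∙ zakTerm l φ : Submodule ℂ L2Ω))
      (fun l => (ℂ ∙ zakTerm l φ : Submodule ℂ L2Ω).subtypeₗᵢ) := by
    refine OrthogonalFamily.of_pairwise fun l k hlk => ?_
    refine Submodule.isOrtho_span.2 ?_
    rintro _ rfl _ rfl
    rw [inner_zakTerm, if_neg hlk]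
  exact (hV.summable_iff_norm_sq_summable
    (fun l => ⟨zakTerm l φ, Submodule.mem_span_singleton_self _⟩)).2 (hasSum_norm_sq_zakTerm φ).summable

/-- The Zak transform `(Zφ)(θ,σ) = ∑_l φ(σ - l) exp(2πilθ)`, the series converging in `L²(Ω)`. -/
def zakLin : H →ₗ[ℂ] L2Ω where
  toFun φ := ∑' l : ℤ, zakTerm l φ
  map_add' φ ψ := by
    simp_rw [map_add]; exact (summable_zakTerm φ).tsum_add (summable_zakTerm ψ)
  map_smul' c φ := by
    simp_rw [map_smul]; exact (summable_zakTerm φ).tsum_const_smul c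

lemma hasSum_zakLin (φ : H) : HasSum (fun l => zakTerm l φ) (zakLin φ) :=
  (summable_zakTerm φ).hasSum

lemma norm_zakLin (φ : H) : ‖zakLin φ‖ = ‖φ‖ := by
  have h1 : ∀ l, ⟪zakTerm l φ, zakLin φ⟫_ℂ = ((‖zakTerm l φ‖ ^ 2 : ℝ) : ℂ) := by
    intro l
    have h := (innerSL ℂ (zakTerm l φ)).hasSum (hasSum_zakLin φ)
    have h' : HasSum (fun k => ⟪zakTerm l φ, zakTerm k φ⟫_ℂ) (⟪zakTerm l φ, zakTerm l φ⟫_ℂ) :=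
      hasSum_single l fun k hk => by rw [inner_zakTerm, if_neg (Ne.symm hk)]
    have := h.unique h'
    simp only [innerSL_apply_apply] at this
    rw [this, inner_self_eq_norm_sq_to_K]; push_cast; rfl
  have h2 := (innerSL ℂ (zakLin φ)).hasSum (hasSum_zakLin φ)
  have h3 : HasSum (fun l => ⟪zakLin φ, zakTerm l φ⟫_ℂ) ((‖φ‖ ^ 2 : ℝ) : ℂ) := by
    have : HasSum (fun l => ((‖zakTerm l φ‖ ^ 2 : ℝ) : ℂ)) ((‖φ‖ ^ 2 : ℝ) : ℂ) :=
      Complex.ofRealCLM.hasSum (hasSum_norm_sq_zakTerm φ)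
    convert this using 1
    · ext l
      rw [← inner_conj_symm, h1, Complex.conj_ofReal]
  have h4 := h2.unique h3
  simp only [innerSL_apply_apply] at h4
  rw [inner_self_eq_norm_sq_to_K] at h4
  have h5 : ‖zakLin φ‖ ^ 2 = ‖φ‖ ^ 2 := by
    apply Complex.ofReal_injective; rw [← h4]; push_cast; rfl
  exact (sq_eq_sq₀ (norm_nonneg _) (norm_nonneg _)).1 h5

lemma zakLin_eq_zakTerm (l : ℤ) (φ : H)
    (h : ∀ᵐ t, t ∉ Ico (-(l : ℝ)) (-l + 1) → φ t = 0) : zakLin φ = zakTerm l φ := by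
  refine (hasSum_zakLin φ).unique (hasSum_single l fun k hk => ?_)
  rw [Lp.eq_zero_iff_ae_eq_zero]
  have hΩ : ∀ᵐ w ∂(volume.restrict Ω : Measure (ℝ × ℝ)), w ∈ Ω :=
    ae_restrict_mem (measurableSet_Ico.prod measurableSet_Ico)
  filter_upwards [zakTerm_coeFn k φ, ae_Ω_of_ae h k, hΩ] with w h1 h2 h3
  rw [h1, zakTermFun, h2, mul_zero, Pi.zero_apply]
  rintro ⟨h4, h5⟩
  have h6 := h3.2.1
  have h7 := h3.2.2
  apply hk
  have e1 : (k : ℝ) < l + 1 := by linarith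
  have e2 : (l : ℝ) < k + 1 := by linarith
  have e1' : k < l + 1 := by exact_mod_cast e1
  have e2' : l < k + 1 := by exact_mod_cast e2
  omega

lemma integrable_phase_mul (F : L2Ω) (l : ℤ) :
    Integrable (fun w : ℝ × ℝ => phase (-l * w.1) * F w)
      ((volume.restrict (Ico (0:ℝ) 1)).prod (volume.restrict (Ico (0:ℝ) 1))) := by
  have h := memLp_phase_mul (u := fun w : ℝ × ℝ => -l * w.1) (by fun_prop) (Lp.memLp F)
  exact integrable_prod_of_Ω (h.integrable (by norm_num))

lemma ae_fourier_zero (F : L2Ω) (hF : ∀ φ, ⟪zakLin φ, F⟫_ℂ = 0) (l : ℤ) :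
    ∀ᵐ s ∂(volume.restrict (Ico (0:ℝ) 1)), ∫ θ in Ico (0:ℝ) 1, phase (-l * θ) * F (θ, s) = 0 := by
  have hint := integrable_phase_mul F l
  refine hint.integral_prod_right.ae_eq_zero_of_forall_setIntegral_eq_zero fun s hs _ => ?_
  set A : Set ℝ := (fun t => t + (l : ℝ)) ⁻¹' (s ∩ Ico 0 1) with hA
  have hAm : MeasurableSet A := (measurable_id.add_const _) (hs.inter measurableSet_Ico)
  have hAsub : A ⊆ Ico (-(l : ℝ)) (-l + 1) := by
    rintro t ⟨_, h1, h2⟩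
    simp only at h1 h2
    exact ⟨by linarith, by linarith⟩
  have hAfin : volume A ≠ ∞ := ((measure_mono hAsub).trans_lt (by simp)).ne
  set φ : H := indicatorConstLp 2 hAm hAfin (1 : ℂ)
  have hφ : φ =ᵐ[volume] A.indicator fun _ => (1 : ℂ) := indicatorConstLp_coeFn
  have hz : zakLin φ = zakTerm l φ := by
    refine zakLin_eq_zakTerm l φ ?_
    filter_upwards [hφ] with t ht hn
    rw [ht, indicator_of_notMem fun h => hn (hAsub h)]
  have h0 := hF φ
  rw [hz, L2.inner_def] at h0
  have h1 : ∫ w in Ω, ⟪zakTerm l φ w, F w⟫_ℂ =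
      ∫ w in Ω, (univ ×ˢ s).indicator (fun w => phase (-l * w.1) * F w) w := by
    refine integral_congr_ae ?_
    have hΩ : ∀ᵐ w ∂(volume.restrict Ω : Measure (ℝ × ℝ)), w ∈ Ω :=
      ae_restrict_mem (measurableSet_Ico.prod measurableSet_Ico)
    filter_upwards [zakTerm_coeFn l φ, ae_Ω_of_ae hφ l, hΩ] with w h1 h2 h3
    rw [h1, zakTermFun, h2]
    by_cases hw : w.2 ∈ s
    · have e1 : w.2 - l ∈ A := by
        simp only [hA, mem_preimage, sub_add_cancel]; exact ⟨hw, h3.2⟩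
      have e2 : w ∈ univ ×ˢ s := ⟨mem_univ _, hw⟩
      rw [indicator_of_mem e1, indicator_of_mem e2, mul_one, RCLike.inner_apply', conj_phase,
        neg_mul]
    · have e1 : w.2 - l ∉ A := by
        simp only [hA, mem_preimage, sub_add_cancel]; exact fun h => hw h.1
      have e2 : w ∉ univ ×ˢ s := fun h => hw h.2
      rw [indicator_of_notMem e1, indicator_of_notMem e2, mul_zero, inner_zero_left]
  rw [h1, integral_Ω, integral_indicator (MeasurableSet.univ.prod hs), ← Measure.prod_restrict,
    Measure.restrict_univ, integral_prod_symm] at h0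
  · exact h0
  · have := hint.restrict (s := univ ×ˢ s)
    rwa [← Measure.prod_restrict, Measure.restrict_univ] at this

lemma eq_zero_of_inner_zakLin (F : L2Ω) (hF : ∀ φ, ⟪zakLin φ, F⟫_ℂ = 0) : F = 0 := by
  have h1 := ae_all_iff.2 (ae_fourier_zero F hF)
  have hsq : Integrable (fun w => ‖F w‖ ^ 2)
      ((volume.restrict (Ico (0:ℝ) 1)).prod (volume.restrict (Ico (0:ℝ) 1))) := by
    have := (Lp.memLp F).integrable_norm_pow (by norm_num)
    exact integrable_prod_of_Ω (by simpa using this)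
  have h2 : ∀ᵐ s ∂(volume.restrict (Ico (0:ℝ) 1)), ∫ θ in Ico (0:ℝ) 1, ‖F (θ, s)‖ ^ 2 = 0 := by
    filter_upwards [h1, hsq.prod_left_ae] with s hs1 hs2
    have hm : AEStronglyMeasurable (fun θ => F (θ, s)) (volume.restrict (Ico (0:ℝ) 1)) :=
      ((Lp.stronglyMeasurable F).comp_measurable measurable_prodMk_right).aestronglyMeasurable
    have hL : MemLp (fun θ => F (θ, s)) 2 (volume.restrict (Ioc (0:ℝ) 1)) := by
      rw [← restrict_Ico_eq_restrict_Ioc]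
      exact (memLp_two_iff_integrable_sq_norm hm).2 hs2
    have hP := hasSum_sq_fourierCoeffOn zero_lt_one hL
    have hc : ∀ n : ℤ, fourierCoeffOn zero_lt_one (fun θ => F (θ, s)) n = 0 := by
      intro n
      rw [fourierCoeffOn_eq_integral, intervalIntegral.integral_of_le zero_le_one,
        ← integral_Ico_eq_integral_Ioc]
      have : ∀ θ : ℝ, (fourier (-n) (θ : AddCircle ((1:ℝ) - 0)) : ℂ) = phase (-n * θ) := by
        intro θ
        rw [fourier_coe_apply, phase]; congr 1; push_cast; ring
      simp_rw [this, smul_eq_mul, hs1 n, smul_zero]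
    simp only [hc, norm_zero, ne_eq, OfNat.ofNat_ne_zero, not_false_eq_true, zero_pow] at hP
    have := hP.unique hasSum_zero
    rw [intervalIntegral.integral_of_le zero_le_one, ← integral_Ico_eq_integral_Ioc] at this
    simpa using this
  have h3 : ∫ w, ‖F w‖ ^ 2
      ∂((volume.restrict (Ico (0:ℝ) 1)).prod (volume.restrict (Ico (0:ℝ) 1))) = 0 := by
    rw [integral_prod_symm _ hsq]
    exact integral_eq_zero_of_ae h2
  rw [integral_eq_zero_iff_of_nonneg (fun _ => sq_nonneg _) hsq] at h3
  rw [Lp.eq_zero_iff_ae_eq_zero]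
  refine ae_Ω_iff.2 ?_
  filter_upwards [h3] with w hw
  simpa using hw

lemma zakLin_surjective : Function.Surjective zakLin := by
  let Z : H →ₗᵢ[ℂ] L2Ω := ⟨zakLin, norm_zakLin⟩
  have hc : IsClosed (LinearMap.range Z.toLinearMap : Set L2Ω) := by
    have := Z.isometry.isClosedEmbedding.isClosed_range
    exact this
  have : CompleteSpace (LinearMap.range Z.toLinearMap) := hc.completeSpace_coe
  have hb : (LinearMap.range Z.toLinearMap)ᗮ = ⊥ := by
    rw [Submodule.eq_bot_iff]
    intro F hF
    refine eq_zero_of_inner_zakLin F fun φ => ?_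
    exact (Submodule.mem_orthogonal _ _).1 hF _ ⟨φ, rfl⟩
  have ht := (Submodule.orthogonal_eq_bot_iff).1 hb
  exact LinearMap.range_eq_top.1 ht

/-- The Zak transform as a unitary map `L²(ℝ) → L²(Ω)`. -/
def zak : H ≃ₗᵢ[ℂ] L2Ω := LinearIsometryEquiv.ofSurjective ⟨zakLin, norm_zakLin⟩ zakLin_surjective

theorem zak_eq_tsum (φ : H) : zak φ = ∑' l : ℤ, zakTerm l φ := rfl

/-- The quasi-periodic extension of `Zφ` from `Ω` to the plane, determined by
`(Zφ)(θ + 1, σ) = (Zφ)(θ, σ)` and `(Zφ)(θ, σ + 1) = exp(2πiθ) (Zφ)(θ, σ)`. -/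
def zakExt (φ : H) (w : ℝ × ℝ) : ℂ :=
  phase (⌊w.2⌋ * w.1) * zak φ (Int.fract w.1, Int.fract w.2)

/-- The domain `{φ ∈ L²(ℝ) | g · Zφ ∈ L²(Ω)}` of `M_g`. -/
def mulZakDomain (g : ℝ × ℝ → ℂ) : Submodule ℂ H where
  carrier := {φ | MemLp (fun w => g w * zak φ w) 2 (volume.restrict Ω)}
  zero_mem' := by
    have h0 : (zak 0 : L2Ω) =ᵐ[volume.restrict Ω] 0 := by
      rw [map_zero]; exact Lp.coeFn_zero _ _ _
    refine (memLp_congr_ae (f := fun _ => (0 : ℂ)) ?_).1 MemLp.zero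
    filter_upwards [h0] with w hw
    rw [hw, Pi.zero_apply, mul_zero]
  add_mem' {φ ψ} hφ hψ := by
    refine (memLp_congr_ae ?_).1 (hφ.add hψ)
    have h : (zak (φ + ψ) : L2Ω) =ᵐ[volume.restrict Ω] zak φ + zak ψ := by
      rw [map_add]; exact Lp.coeFn_add _ _
    filter_upwards [h] with w hw
    simp only [hw, Pi.add_apply, mul_add]
  smul_mem' c φ hφ := by
    refine (memLp_congr_ae ?_).1 (hφ.const_smul c)
    have h : (zak (c • φ) : L2Ω) =ᵐ[volume.restrict Ω] c • zak φ := by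
      rw [map_smul]; exact Lp.coeFn_smul _ _
    filter_upwards [h] with w hw
    simp only [hw, Pi.smul_apply, smul_eq_mul]; ring

lemma memLp_of_mem_mulZakDomain {g : ℝ × ℝ → ℂ} {φ : H} (h : φ ∈ mulZakDomain g) :
    MemLp (fun w => g w * zak φ w) 2 (volume.restrict Ω) := h

/-- The (in general unbounded) operator `M_g φ = Z⁻¹(g · Zφ)` on `{φ | g · Zφ ∈ L²(Ω)}`. -/
def mulZak (g : ℝ × ℝ → ℂ) : H →ₗ.[ℂ] H where
  domain := mulZakDomain g
  toFun :=
    { toFun := fun φ => zak.symm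
        (MemLp.toLp (fun w => g w * zak (φ : H) w) (memLp_of_mem_mulZakDomain φ.2))
      map_add' := fun φ ψ => by
        rw [← map_add, ← MemLp.toLp_add]
        congr 1
        refine MemLp.toLp_congr _ _ ?_
        have h : (zak ((φ + ψ : mulZakDomain g) : H) : L2Ω) =ᵐ[volume.restrict Ω]
            zak (φ : H) + zak (ψ : H) := by
          rw [Submodule.coe_add, map_add]; exact Lp.coeFn_add _ _
        filter_upwards [h] with w hw
        simp only [hw, Pi.add_apply, mul_add]
      map_smul' := fun c φ => by
        rw [RingHom.id_apply, ← map_smul, ← MemLp.toLp_const_smul]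
        congr 1
        refine MemLp.toLp_congr _ _ ?_
        have h : (zak ((c • φ : mulZakDomain g) : H) : L2Ω) =ᵐ[volume.restrict Ω]
            c • zak (φ : H) := by
          rw [Submodule.coe_smul, map_smul]; exact Lp.coeFn_smul _ _
        filter_upwards [h] with w hw
        simp only [hw, Pi.smul_apply, smul_eq_mul]; ring }

/-- `ρ(w, 1)` as a bounded operator, `w ∈ ℝ²`. -/
def rhoOp (w : ℝ × ℝ) : H →L[ℂ] H := (rho w.1 w.2 1).toContinuousLinearEquiv

/-- `ρ(w, 1)⁻¹` as a bounded operator. -/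
def rhoInv (w : ℝ × ℝ) : H →L[ℂ] H := (rho w.1 w.2 1).symm.toContinuousLinearEquiv

/-- The product `T U` of an unbounded operator `T` and a bounded operator `U`, on the natural
domain `{f | U f ∈ dom T}`. -/
def compRight (T : H →ₗ.[ℂ] H) (U : H →L[ℂ] H) : H →ₗ.[ℂ] H where
  domain := T.domain.comap (U : H →ₗ[ℂ] H)
  toFun := T.toFun ∘ₗ (U : H →ₗ[ℂ] H).submoduleComap T.domain

/-- The product `U T` of a bounded operator `U` and an unbounded operator `T`. -/
def compLeft (U : H →L[ℂ] H) (T : H →ₗ.[ℂ] H) : H →ₗ.[ℂ] H := (U : H →ₗ[ℂ] H).compPMap T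

/-- A bounded operator, as an unbounded operator with domain the whole space. -/
def ofBounded (B : H →L[ℂ] H) : H →ₗ.[ℂ] H := (B : H →ₗ[ℂ] H).toPMap ⊤

/-- The lattice `N = ℤ × aℤ`. -/
def lattice (a : ℕ) : Set (ℝ × ℝ) := {w | ∃ k l : ℤ, w = ((k : ℝ), (a : ℝ) * l)}

/-- The dual lattice `N^⊥ = {w | e(n, w) = 1 for all n ∈ N}`, with
`e((x,y),(x',y')) = exp(2πi(xy' - yx'))`. -/
def dualLattice (a : ℕ) : Set (ℝ × ℝ) :=
  {w | ∀ n ∈ lattice a, phase (n.1 * w.2 - n.2 * w.1) = 1}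

/-- `T` is `N`-periodic: `ρ(n,1) T ρ(n,1)⁻¹ = T` for all `n ∈ N` (equality of domains included). -/
def IsPeriodic (a : ℕ) (T : H →ₗ.[ℂ] H) : Prop :=
  ∀ n ∈ lattice a, compLeft (rhoOp n) (compRight T (rhoInv n)) = T

/-- The von Neumann algebra `A_N` of bounded `N`-periodic operators. -/
def algA (a : ℕ) : Set (H →L[ℂ] H) :=
  {T | ∀ n ∈ lattice a, rhoOp n ∘L T ∘L rhoInv n = T}

/-- The indicator function of `[h/a, (h+1)/a)` in `L²(ℝ)`. -/
def chi (a h : ℕ) : H :=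
  indicatorConstLp 2 (measurableSet_Ico : MeasurableSet (Ico ((h : ℝ) / a) (((h : ℝ) + 1) / a)))
    (by simp) (1 : ℂ)

/-- The trace `τ(T) = ∑_{h<a} ⟨T χ_h, χ_h⟩` on `A_N` (Mathlib's inner product is linear in the
second variable). -/
def tau (a : ℕ) (T : H →L[ℂ] H) : ℂ := ∑ h ∈ Finset.range a, ⟪chi a h, T (chi a h)⟫_ℂ

/-- The distribution function `τ(χ_{(t,∞)}(|T|))` of a closed densely defined operator affiliated
with `A_N`, in its usual variational form: the infimum of `τ(1 - p)` over the projections `p ∈ A_N`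
with `p L²(ℝ) ⊆ dom T` and `‖T p‖ ≤ t`. (It is attained at `p = χ_{[0,t]}(|T|)`.) -/
def distribution (a : ℕ) (T : H →ₗ.[ℂ] H) (t : ℝ) : ℝ≥0∞ :=
  ⨅ p ∈ {p : H →L[ℂ] H | p ∈ algA a ∧ IsStarProjection p ∧
    ∀ f : H, ∃ hf : p f ∈ T.domain, ‖T ⟨p f, hf⟩‖ ≤ t * ‖f‖}, ENNReal.ofReal (tau a (1 - p)).re

/-- `‖T‖₁ = τ(|T|) = ∫_0^∞ τ(χ_{(t,∞)}(|T|)) dt`. -/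
def oneNorm (a : ℕ) (T : H →ₗ.[ℂ] H) : ℝ≥0∞ := ∫⁻ t in Ioi (0 : ℝ), distribution a T t

/-- `T ∈ L¹(A_N, τ)`: `T` is closed, densely defined, affiliated with `A_N` (that is,
`N`-periodic), and `‖T‖₁ < ∞`. (As `A_N` is finite, such a `T` is measurable.) -/
def MemL1 (a : ℕ) (T : H →ₗ.[ℂ] H) : Prop :=
  T.IsClosed ∧ Dense (T.domain : Set H) ∧ IsPeriodic a T ∧ oneNorm a T < ∞

/-- `τ(T) = c` for `T ∈ L¹(A_N, τ)`, where `τ` is extended from `A_N` to `L¹(A_N, τ)` by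
`‖·‖₁`-continuity: `c` is the limit of `τ(B_n)` for some `B_n ∈ A_N` with `‖T - B_n‖₁ → 0`.
(Such `B_n` exist, and the limit does not depend on them, because `|τ(B)| ≤ ‖B‖₁` on `A_N`.) -/
def HasTau (a : ℕ) (T : H →ₗ.[ℂ] H) (c : ℂ) : Prop :=
  MemL1 a T ∧ ∃ B : ℕ → (H →L[ℂ] H), (∀ n, B n ∈ algA a) ∧
    Tendsto (fun n => oneNorm a (T - ofBounded (B n))) atTop (𝓝 0) ∧
    Tendsto (fun n => tau a (B n)) atTop (𝓝 c)

/-- The Fourier–Wigner coefficient of `T ∈ L¹(A_N, τ)` at `n'` is `c`: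
`τ(T ρ(n',1)^*) = c`. -/
def HasFourierWignerCoeff (a : ℕ) (T : H →ₗ.[ℂ] H) (n' : ℝ × ℝ) (c : ℂ) : Prop :=
  HasTau a (compRight T (ContinuousLinearMap.adjoint (rhoOp n'))) c

/-- The sum of finitely many unbounded operators in the algebra of measurable operators: the
closure of their algebraic sum (defined on the intersection of the domains). -/
def strongSum {n : ℕ} (T : Fin n → (H →ₗ.[ℂ] H)) : H →ₗ.[ℂ] H := (∑ i, T i).closure

/-- `g_j(θ,σ) = (Zφ)(θ,σ) · conj((Zψ)(θ, σ - j/a))`. -/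
def gFun (a j : ℕ) (φ ψ : H) (w : ℝ × ℝ) : ℂ :=
  zakExt φ w * conj (zakExt ψ (w.1, w.2 - (j : ℝ) / a))

/-- The periodization `∑_{j<a} M_{g_j} ρ(-j/a, 0, 1)` of the rank-one operator `φ ⊗ ψ̄`. -/
def periodizationRankOne (a : ℕ) (φ ψ : H) : H →ₗ.[ℂ] H :=
  strongSum fun j : Fin a => compRight (mulZak (gFun a j φ ψ)) (rhoOp (-((j : ℕ) : ℝ) / a, 0))

/-- `T` is a periodization `X̃` of the finite-rank operator `X`: for some representation
`X = ∑_i φ_i ⊗ ψ̄_i` (where `(φ ⊗ ψ̄) f = ⟨f, ψ⟩ φ`), `T` is the sum of the periodizations of the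
`φ_i ⊗ ψ̄_i`. -/
def IsPeriodization (a : ℕ) (X : H →L[ℂ] H) (T : H →ₗ.[ℂ] H) : Prop :=
  ∃ (n : ℕ) (φ ψ : Fin n → H), X = ∑ i, InnerProductSpace.rankOne ℂ (φ i) (ψ i) ∧
    T = strongSum fun i => periodizationRankOne a (φ i) (ψ i)

/-- An orthonormal basis of `L²(ℝ)`. -/
def onb : HilbertBasis (exists_hilbertBasis ℂ H).choose ℂ H :=
  (exists_hilbertBasis ℂ H).choose_spec.choose

/-- The operator trace `∑_i ⟨X b_i, b_i⟩` over an orthonormal basis `b` of `L²(ℝ)`; for trace class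
`X` the series converges and the sum does not depend on `b`. -/
def opTrace (X : H →L[ℂ] H) : ℂ := ∑' i, ⟪onb i, X (onb i)⟫_ℂ

/-- The modified Fourier–Wigner transform `α(X)(x,y) = tr(X ρ(x,y,1)^*)`. -/
def alpha (X : H →L[ℂ] H) (w : ℝ × ℝ) : ℂ :=
  opTrace (X ∘L ContinuousLinearMap.adjoint (rhoOp w))

end ZakPeriodization

end

noncomputable section

namespace ZakPeriodization

open MeasureTheory Set Filter
open scoped ENNReal InnerProductSpace ComplexConjugate Topology

/-- Measurable functions on `Ω` modulo null sets. -/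
abbrev ZakFun : Type := (ℝ × ℝ) →ₘ[(volume.restrict Ω : Measure (ℝ × ℝ))] ℂ

instance : CommRing ZakFun :=
  { (inferInstance : AddCommGroup ZakFun), (inferInstance : CommMonoid ZakFun) with
    left_distrib := fun a b c => AEEqFun.toGerm_injective (by
      simp only [AEEqFun.mul_toGerm, AEEqFun.add_toGerm, mul_add])
    right_distrib := fun a b c => AEEqFun.toGerm_injective (by
      simp only [AEEqFun.mul_toGerm, AEEqFun.add_toGerm, add_mul])
    zero_mul := fun a => AEEqFun.toGerm_injective (by
      simp only [AEEqFun.mul_toGerm, AEEqFun.zero_toGerm, zero_mul])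
    mul_zero := fun a => AEEqFun.toGerm_injective (by
      simp only [AEEqFun.mul_toGerm, AEEqFun.zero_toGerm, mul_zero]) }

instance : IsScalarTower ℂ ZakFun ZakFun := ⟨fun c F G => by
  refine AEEqFun.ext ?_
  filter_upwards [AEEqFun.coeFn_mul (c • F) G, AEEqFun.coeFn_smul c F,
    AEEqFun.coeFn_smul c (F * G), AEEqFun.coeFn_mul F G] with w h1 h2 h3 h4
  simp only [smul_eq_mul, h1, h2, h3, h4, Pi.mul_apply, Pi.smul_apply, mul_assoc]⟩

instance : SMulCommClass ℂ ZakFun ZakFun := ⟨fun c F G => by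
  rw [smul_eq_mul, smul_eq_mul, mul_comm F (c • G), smul_mul_assoc, mul_comm F]⟩

/-- The Zak transform with values in measurable functions modulo null sets. -/
def zakAE : H →ₗ[ℂ] ZakFun where
  toFun f := (zak f : L2Ω)
  map_add' f g := by rw [map_add]; rfl
  map_smul' c f := by rw [map_smul]; rfl

lemma zakAE_coeFn (f : H) : ((zakAE f : ZakFun) : ℝ × ℝ → ℂ) = zak f := rfl

lemma zakAE_injective : Function.Injective zakAE := fun _ _ h =>
  zak.injective (Subtype.ext h)

lemma exists_zakAE_eq_iff {F : ZakFun} : (∃ g, zakAE g = F) ↔ F ∈ Lp ℂ 2 (volume.restrict Ω) := by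
  constructor
  · rintro ⟨g, rfl⟩; exact (zak g).2
  · intro h
    exact ⟨zak.symm ⟨F, h⟩, by simp [zakAE]⟩

/-- The operator whose graph is `{(f, g) | Z g = L f}`. -/
def zakOp (L : H →ₗ[ℂ] ZakFun) : H →ₗ.[ℂ] H where
  domain := (Lp.LpSubmodule ℂ ℂ 2 (volume.restrict Ω)).comap L
  toFun :=
    { toFun := fun f => zak.symm ⟨L f, f.2⟩
      map_add' := fun f g => by
        rw [← map_add]; congr 1; exact Subtype.ext (map_add L (f : H) g)
      map_smul' := fun c f => by
        rw [RingHom.id_apply, ← map_smul]; congr 1; exact Subtype.ext (map_smul L c (f : H)) }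

lemma zakAE_zakOp (L : H →ₗ[ℂ] ZakFun) (f : (zakOp L).domain) : zakAE (zakOp L f) = L f := by
  change ((zak (zak.symm ⟨L f, f.2⟩) : L2Ω) : ZakFun) = L f
  rw [LinearIsometryEquiv.apply_symm_apply]

lemma mem_domain_zakOp {L : H →ₗ[ℂ] ZakFun} {f : H} :
    f ∈ (zakOp L).domain ↔ ∃ g, zakAE g = L f := exists_zakAE_eq_iff.symm

lemma mem_graph_zakOp {L : H →ₗ[ℂ] ZakFun} {f g : H} :
    (f, g) ∈ (zakOp L).graph ↔ zakAE g = L f := by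
  rw [LinearPMap.mem_graph_iff]
  constructor
  · rintro ⟨y, rfl, rfl⟩; exact zakAE_zakOp L y
  · intro h
    refine ⟨⟨f, mem_domain_zakOp.2 ⟨g, h⟩⟩, rfl, zakAE_injective ?_⟩
    rw [zakAE_zakOp, h]

lemma mem_graph_compRight {T : H →ₗ.[ℂ] H} {U : H →L[ℂ] H} {f g : H} :
    (f, g) ∈ (compRight T U).graph ↔ (U f, g) ∈ T.graph := by
  simp only [LinearPMap.mem_graph_iff]
  constructor
  · rintro ⟨y, rfl, rfl⟩; exact ⟨⟨U y, y.2⟩, rfl, rfl⟩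
  · rintro ⟨y, h, rfl⟩
    refine ⟨⟨f, ?_⟩, rfl, ?_⟩
    · change U f ∈ T.domain; rw [← show (y : H) = U f from h]; exact y.2
    · change T ⟨U f, _⟩ = T y; congr 1; exact Subtype.ext h.symm

lemma mem_graph_compLeft {T : H →ₗ.[ℂ] H} {U : H →L[ℂ] H} {f g : H} :
    (f, g) ∈ (compLeft U T).graph ↔ ∃ g', (f, g') ∈ T.graph ∧ U g' = g := by
  simp only [LinearPMap.mem_graph_iff]
  constructor
  · rintro ⟨y, rfl, rfl⟩; exact ⟨T y, ⟨y, rfl, rfl⟩, rfl⟩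
  · rintro ⟨_, ⟨y, rfl, rfl⟩, rfl⟩; exact ⟨y, rfl, rfl⟩

lemma compRight_zakOp (L : H →ₗ[ℂ] ZakFun) (U : H →L[ℂ] H) :
    compRight (zakOp L) U = zakOp (L ∘ₗ (U : H →ₗ[ℂ] H)) := by
  refine LinearPMap.eq_of_eq_graph (Submodule.ext fun ⟨f, g⟩ => ?_)
  rw [mem_graph_compRight, mem_graph_zakOp, mem_graph_zakOp]; rfl

/-- Multiplication by a fixed function, as a linear map. -/
def mulAE (β : ZakFun) : ZakFun →ₗ[ℂ] ZakFun where
  toFun F := β * F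
  map_add' F G := mul_add β F G
  map_smul' c F := mul_smul_comm c β F

@[simp] lemma mulAE_apply (β F : ZakFun) : mulAE β F = β * F := rfl

lemma mulZak_eq_zakOp {g : ℝ × ℝ → ℂ} (hg : AEStronglyMeasurable g (volume.restrict Ω)) :
    mulZak g = zakOp (mulAE (AEEqFun.mk g hg) ∘ₗ zakAE) := by
  have key : ∀ f : H, (mulAE (AEEqFun.mk g hg) ∘ₗ zakAE) f =ᵐ[volume.restrict Ω]
      fun w => g w * zak f w := by
    intro f
    filter_upwards [AEEqFun.coeFn_mul (AEEqFun.mk g hg) (zakAE f), AEEqFun.coeFn_mk g hg]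
      with w h1 h2
    simp only [LinearMap.comp_apply, mulAE_apply, h1, Pi.mul_apply, h2, zakAE_coeFn]
  refine LinearPMap.ext (Submodule.ext fun f => ?_) fun f hf hf' => ?_
  · rw [mem_domain_zakOp, exists_zakAE_eq_iff, Lp.mem_Lp_iff_memLp, memLp_congr_ae (key f)]; rfl
  · change zak.symm _ = zak.symm _
    congr 1
    refine Lp.ext ((MemLp.coeFn_toLp (memLp_of_mem_mulZakDomain hf)).trans ?_)
    exact (key f).symm

lemma zakOp_sub_ofBounded {L L' : H →ₗ[ℂ] ZakFun} {B : H →L[ℂ] H}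
    (h : ∀ f, L' f = L f - zakAE (B f)) : zakOp L - ofBounded B = zakOp L' := by
  refine LinearPMap.ext (Submodule.ext fun f => ?_) fun f hf hf' => ?_
  · rw [LinearPMap.sub_domain, Submodule.mem_inf, mem_domain_zakOp, mem_domain_zakOp]
    constructor
    · rintro ⟨⟨g, hg⟩, -⟩; exact ⟨g - B f, by rw [map_sub, hg, h]⟩
    · rintro ⟨g, hg⟩
      exact ⟨⟨g + B f, by rw [map_add, hg, h, sub_add_cancel]⟩, Submodule.mem_top⟩
  · apply zakAE_injective
    rw [zakAE_zakOp, LinearPMap.sub_apply, map_sub, zakAE_zakOp, h]; rfl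

lemma norm_le_of_zakAE_le {f g : H} {C : ℝ}
    (h : ∀ᵐ w ∂(volume.restrict Ω : Measure (ℝ × ℝ)), ‖zakAE g w‖ ≤ C * ‖zakAE f w‖) :
    ‖g‖ ≤ C * ‖f‖ := by
  rw [← zak.norm_map f, ← zak.norm_map g]
  exact Lp.norm_le_mul_norm_of_ae_le_mul h

/-- Multiplication of the Zak transform by a bounded function is a bounded operator. -/
lemma exists_mulOp {b : ℝ × ℝ → ℂ} (hb : AEStronglyMeasurable b (volume.restrict Ω)) {C : ℝ}
    (hC : ∀ᵐ w ∂(volume.restrict Ω : Measure (ℝ × ℝ)), ‖b w‖ ≤ C) :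
    ∃ M : H →L[ℂ] H, (∀ f, zakAE (M f) = AEEqFun.mk b hb * zakAE f) ∧ ∀ f, ‖M f‖ ≤ C * ‖f‖ := by
  have key : ∀ f : H, ∀ᵐ w ∂(volume.restrict Ω : Measure (ℝ × ℝ)),
      ‖(AEEqFun.mk b hb * zakAE f : ZakFun) w‖ ≤ C * ‖zakAE f w‖ := by
    intro f
    filter_upwards [AEEqFun.coeFn_mul (AEEqFun.mk b hb) (zakAE f), AEEqFun.coeFn_mk b hb, hC]
      with w h1 h2 h3
    rw [h1, Pi.mul_apply, h2, norm_mul]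
    exact mul_le_mul_of_nonneg_right h3 (norm_nonneg _)
  have hmem : ∀ f : H, ∃ g, zakAE g = AEEqFun.mk b hb * zakAE f := fun f =>
    exists_zakAE_eq_iff.2 (Lp.mem_Lp_iff_memLp.2
      ((Lp.memLp (zak f)).of_le_mul (AEEqFun.aestronglyMeasurable _) (key f)))
  choose m hm using hmem
  have hbound : ∀ f, ‖m f‖ ≤ C * ‖f‖ := fun f =>
    norm_le_of_zakAE_le (by rw [hm]; exact key f)
  refine ⟨LinearMap.mkContinuous
    { toFun := m
      map_add' := fun f g => zakAE_injective (by simp only [hm, map_add, mul_add])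
      map_smul' := fun c f => zakAE_injective (by
        simp only [hm, map_smul, RingHom.id_apply, mul_smul_comm]) } C hbound, hm, hbound⟩

lemma ae_mem_Ω : ∀ᵐ w ∂(volume.restrict Ω : Measure (ℝ × ℝ)), w ∈ Ω :=
  ae_restrict_mem (measurableSet_Ico.prod measurableSet_Ico)

lemma measurePreserving_fract_sub (s : ℝ) :
    MeasurePreserving (fun t : ℝ => Int.fract (t - s))
      (volume.restrict (Ico (0:ℝ) 1)) (volume.restrict (Ico (0:ℝ) 1)) := by
  have hm : Measurable fun t : ℝ => Int.fract (t - s) :=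
    measurable_fract.comp (measurable_id.sub_const s)
  refine ⟨hm, Measure.ext fun A hA => ?_⟩
  rw [Measure.map_apply hm hA, Measure.restrict_apply (hm hA), Measure.restrict_apply hA]
  have hB : MeasurableSet (Int.fract ⁻¹' A : Set ℝ) := measurable_fract hA
  have h1 : (fun t : ℝ => Int.fract (t - s)) ⁻¹' A ∩ Ico 0 1 =
      (fun t => t - s) ⁻¹' (Int.fract ⁻¹' A ∩ Ico (-s) (-s + 1)) := by
    ext t
    simp only [mem_inter_iff, mem_preimage, mem_Ico]
    constructor <;> rintro ⟨h, h2, h3⟩ <;> exact ⟨h, by linarith, by linarith⟩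
  have h2 : A ∩ Ico (0:ℝ) 1 = Int.fract ⁻¹' A ∩ Ico 0 (0 + 1) := by
    ext t
    simp only [mem_inter_iff, mem_preimage, zero_add]
    refine and_congr_left fun ht => ?_
    rw [Int.fract_eq_self.2 ht]
  rw [h1, (measurePreserving_sub_right volume s).measure_preimage
    (hB.inter measurableSet_Ico).nullMeasurableSet, h2]
  have hae : ∀ x : ℝ, volume (Int.fract ⁻¹' A ∩ Ico x (x + 1)) =
      volume (Int.fract ⁻¹' A ∩ Ioc x (x + 1)) := fun x =>
    measure_congr ((ae_eq_refl _).inter Ico_ae_eq_Ioc)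
  rw [hae, hae]
  refine (isAddFundamentalDomain_Ioc one_pos (-s)).measure_set_eq
    (isAddFundamentalDomain_Ioc one_pos 0) hB fun g => ?_
  obtain ⟨n, hn⟩ := AddSubgroup.mem_zmultiples_iff.1 g.2
  ext t
  have : (g : ℝ) = n := by rw [← hn]; simp
  simp only [mem_preimage, AddSubgroup.vadd_def, vadd_eq_add, this, Int.fract_intCast_add]

/-- The shift `(θ, σ) ↦ (θ, σ - s)` of the torus. -/
def torusShift (s : ℝ) (w : ℝ × ℝ) : ℝ × ℝ := (w.1, Int.fract (w.2 - s))

lemma measurePreserving_torusShift (s : ℝ) :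
    MeasurePreserving (torusShift s) (volume.restrict Ω) (volume.restrict Ω) := by
  rw [vol_Ω]
  exact (MeasurePreserving.id _).prod (measurePreserving_fract_sub s)

lemma measurable_shiftPhase (s : ℝ) :
    Measurable fun w : ℝ × ℝ => phase (⌊w.2 - s⌋ * w.1) := by
  refine continuous_phase.measurable.comp (Measurable.mul ?_ measurable_fst)
  exact (measurable_from_top (f := fun n : ℤ => (n : ℝ))).comp
    (Int.measurable_floor.comp (measurable_snd.sub_const s))

/-- The quasi-periodic shift `F ↦ F(θ, σ - s)`. -/
def shiftAE (s : ℝ) (F : ZakFun) : ZakFun :=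
  AEEqFun.mk _ (measurable_shiftPhase s).aestronglyMeasurable *
    F.compMeasurePreserving (torusShift s) (measurePreserving_torusShift s)

lemma shiftAE_coeFn (s : ℝ) (F : ZakFun) : shiftAE s F =ᵐ[volume.restrict Ω]
    fun w => phase (⌊w.2 - s⌋ * w.1) * F (torusShift s w) := by
  filter_upwards [AEEqFun.coeFn_mul
    (AEEqFun.mk _ (measurable_shiftPhase s).aestronglyMeasurable : ZakFun)
    (F.compMeasurePreserving (torusShift s) (measurePreserving_torusShift s)),
    AEEqFun.coeFn_mk _ (measurable_shiftPhase s).aestronglyMeasurable (μ := volume.restrict Ω),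
    AEEqFun.coeFn_compMeasurePreserving F (measurePreserving_torusShift s)] with w h1 h2 h3
  rw [shiftAE, h1, Pi.mul_apply, h2, h3]; rfl

lemma ae_torusShift {p : ℝ × ℝ → Prop} (s : ℝ)
    (h : ∀ᵐ w ∂(volume.restrict Ω : Measure (ℝ × ℝ)), p w) :
    ∀ᵐ w ∂(volume.restrict Ω : Measure (ℝ × ℝ)), p (torusShift s w) :=
  (measurePreserving_torusShift s).quasiMeasurePreserving.ae h

lemma shiftAE_mul (s : ℝ) {β : ZakFun} {b : ℝ × ℝ → ℂ} (hb : β =ᵐ[volume.restrict Ω] b)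
    (hinv : ∀ w ∈ Ω, b (torusShift s w) = b w) (F : ZakFun) :
    shiftAE s (β * F) = β * shiftAE s F := by
  refine AEEqFun.ext ?_
  filter_upwards [shiftAE_coeFn s (β * F), shiftAE_coeFn s F, AEEqFun.coeFn_mul β (shiftAE s F),
    ae_torusShift s (AEEqFun.coeFn_mul β F), hb, ae_torusShift s hb, ae_mem_Ω]
    with w h1 h2 h3 h4 h5 h6 h7
  rw [h1, h3, Pi.mul_apply, h2, h4, Pi.mul_apply, h5, h6, hinv w h7]; ring

lemma zak_of_zakTerm {Φ : L2Ω →L[ℂ] L2Ω} {φ ψ : H} (k : ℤ)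
    (h : ∀ l, Φ (zakTerm (l - k) ψ) = zakTerm l φ) : Φ (zak ψ) = zak φ := by
  have h1 : HasSum (fun l => zakTerm l ψ) (zak ψ) := hasSum_zakLin ψ
  have h2 := Φ.hasSum ((Equiv.subRight k).hasSum_iff.2 h1)
  refine h2.unique ?_
  have h3 : HasSum (fun l => zakTerm l φ) (zak φ) := hasSum_zakLin φ
  convert h3 using 2 with l
  exact h l

lemma exists_mulL2 {b : ℝ × ℝ → ℂ} (hb : AEStronglyMeasurable b (volume.restrict Ω)) {C : ℝ}
    (hC : ∀ᵐ w ∂(volume.restrict Ω : Measure (ℝ × ℝ)), ‖b w‖ ≤ C) :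
    ∃ M : L2Ω →L[ℂ] L2Ω, ∀ F, M F =ᵐ[volume.restrict Ω] fun w => b w * F w := by
  obtain ⟨M, hM, -⟩ := exists_mulOp hb hC
  refine ⟨(zak.toContinuousLinearEquiv : H →L[ℂ] L2Ω) ∘L M ∘L
    (zak.symm.toContinuousLinearEquiv : L2Ω →L[ℂ] H), fun F => ?_⟩
  have h := hM (zak.symm F)
  have h2 : (zakAE (zak.symm F) : ZakFun) = F := by simp [zakAE]
  rw [h2] at h
  change (zakAE (M (zak.symm F)) : ZakFun) =ᵐ[volume.restrict Ω] _
  rw [h]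
  filter_upwards [AEEqFun.coeFn_mul (AEEqFun.mk b hb) (F : ZakFun), AEEqFun.coeFn_mk b hb]
    with w h1 h2
  rw [h1, Pi.mul_apply, h2]

lemma rhoOp_coeFn (w : ℝ × ℝ) (f : H) :
    rhoOp w f =ᵐ[volume] fun t => phase (w.1 * w.2 / 2 + w.2 * t) * f (t + w.1) := by
  filter_upwards [rhoLin_coeFn w.1 w.2 1 f] with t ht
  change rhoLin w.1 w.2 1 f t = _
  rw [ht, rhoFun]; simp

lemma phase_intCast (n : ℤ) : phase n = 1 := by
  have : (2 * Real.pi * Complex.I * ((n : ℝ) : ℂ)) = n * (2 * Real.pi * Complex.I) := by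
    push_cast; ring
  rw [phase, this, Complex.exp_int_mul_two_pi_mul_I]

/-- `ρ(k, q)` with `k, q ∈ ℤ` becomes a multiplication operator. -/
lemma zak_rhoOp_int (k q : ℤ) (f : H) : zak (rhoOp (k, q) f) =ᵐ[volume.restrict Ω]
    fun w => phase (k * q / 2 + q * w.2 + k * w.1) * zak f w := by
  have hb : Continuous fun w : ℝ × ℝ => phase (k * q / 2 + q * w.2 + k * w.1) :=
    continuous_phase.comp (by fun_prop)
  obtain ⟨M, hM⟩ := exists_mulL2 (b := fun w : ℝ × ℝ => phase (k * q / 2 + q * w.2 + k * w.1))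
    hb.aestronglyMeasurable (C := 1) (ae_of_all _ fun w => by simp)
  rw [← zak_of_zakTerm (Φ := M) (φ := rhoOp (k, q) f) (ψ := f) k]
  · exact hM _
  · intro l
    refine Lp.ext ((hM _).trans ?_)
    filter_upwards [zakTerm_coeFn (l - k) f, zakTerm_coeFn l (rhoOp (k, q) f),
      ae_Ω_of_ae (rhoOp_coeFn (k, q) f) l] with w h1 h2 h3
    rw [h1, h2, zakTermFun, zakTermFun, h3, ← mul_assoc, ← mul_assoc, ← phase_add, ← phase_add]
    have e : l * w.1 + ((k : ℝ) * q / 2 + q * (w.2 - l)) =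
        (k * q / 2 + q * w.2 + k * w.1 + ((l - k : ℤ) : ℝ) * w.1) + ((-(q * l) : ℤ) : ℝ) := by
      push_cast; ring
    have e2 : w.2 - l + k = w.2 - ((l - k : ℤ) : ℝ) := by push_cast; ring
    simp only [e, e2, phase_add _ ((-(q * l) : ℤ) : ℝ), phase_intCast, mul_one]

/-- The Zak transform intertwines translations with quasi-periodic shifts. -/
lemma zakAE_translate {s : ℝ} (h0 : 0 ≤ s) (h1 : s < 1) (f : H) :
    zakAE (rhoOp (-s, 0) f) = shiftAE s (zakAE f) := by
  obtain ⟨M, hM⟩ := exists_mulL2 (measurable_shiftPhase s).aestronglyMeasurable (C := 1)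
    (ae_of_all _ fun w => by simp)
  let S : Set (ℝ × ℝ) := {w | s ≤ w.2}
  have hS : MeasurableSet S := measurableSet_le measurable_const measurable_snd
  obtain ⟨P, hP⟩ := exists_mulL2 (b := S.indicator 1)
    (aestronglyMeasurable_one.indicator hS) (C := 1) (ae_of_all _ fun w => by
      by_cases h : w ∈ S <;> simp [h])
  obtain ⟨Q, hQ⟩ := exists_mulL2 (b := Sᶜ.indicator 1)
    (aestronglyMeasurable_one.indicator hS.compl) (C := 1) (ae_of_all _ fun w => by
      by_cases h : w ∈ S <;> simp [h])
  let τ := (Lp.compMeasurePreservingₗᵢ ℂ (torusShift s) (measurePreserving_torusShift s) :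
    L2Ω →ₗᵢ[ℂ] L2Ω).toContinuousLinearMap
  have hτ : ∀ F : L2Ω, M (τ F) =ᵐ[volume.restrict Ω]
      fun w => phase (⌊w.2 - s⌋ * w.1) * F (torusShift s w) := by
    intro F
    filter_upwards [hM (τ F),
      Lp.coeFn_compMeasurePreserving F (measurePreserving_torusShift s)] with w h2 h3
    rw [h2]; congr 1
  set g := rhoOp (-s, 0) f
  have hPQ : ∀ F : L2Ω, P F + Q F = F := by
    intro F
    refine Lp.ext ?_
    filter_upwards [Lp.coeFn_add (P F) (Q F), hP F, hQ F] with w h2 h3 h4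
    rw [h2, Pi.add_apply, h3, h4]
    by_cases h : w ∈ S <;> simp [h]
  have hterm : ∀ l, M (τ (zakTerm l f)) = P (zakTerm l g) + Q (zakTerm (l - 1) g) := by
    intro l
    refine Lp.ext ?_
    filter_upwards [hτ (zakTerm l f), ae_torusShift s (zakTerm_coeFn l f),
      Lp.coeFn_add (P (zakTerm l g)) (Q (zakTerm (l - 1) g)), hP (zakTerm l g),
      hQ (zakTerm (l - 1) g), zakTerm_coeFn l g, zakTerm_coeFn (l - 1) g,
      ae_Ω_of_ae (rhoOp_coeFn (-s, 0) f) l, ae_Ω_of_ae (rhoOp_coeFn (-s, 0) f) (l - 1), ae_mem_Ω]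
      with w h2 h3 h4 h5 h6 h7 h8 h9 h10 hw
    rw [h2, h3, h4, Pi.add_apply, h5, h6, h7, h8]
    simp only [zakTermFun]
    rw [h9, h10]
    simp only [torusShift, mul_zero, zero_div, zero_mul, add_zero, phase_zero, one_mul]
    by_cases h : w ∈ S
    · have hfl : ⌊w.2 - s⌋ = 0 := by
        rw [Int.floor_eq_zero_iff]
        exact ⟨sub_nonneg.2 h, by linarith [hw.2.2]⟩
      have hfr : Int.fract (w.2 - s) = w.2 - s := by rw [Int.fract, hfl]; simp
      have hc : w ∉ Sᶜ := fun h' => h' h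
      rw [hfl, hfr, indicator_of_mem h, indicator_of_notMem hc]
      simp only [Int.cast_zero, zero_mul, phase_zero, one_mul, Pi.one_apply, add_zero]
      congr 2; ring
    · have hlt : w.2 < s := not_le.1 h
      have hfl : ⌊w.2 - s⌋ = -1 := by
        rw [Int.floor_eq_iff]; push_cast
        exact ⟨by linarith [hw.2.1], by linarith⟩
      have hfr : Int.fract (w.2 - s) = w.2 - s + 1 := by rw [Int.fract, hfl]; simp
      have hc : w ∈ Sᶜ := h
      rw [hfl, hfr, indicator_of_notMem h, indicator_of_mem hc, ← mul_assoc, ← phase_add]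
      simp only [zero_mul, zero_add, one_mul, Pi.one_apply]
      congr 2 <;> (push_cast; ring)
  have hsum : HasSum (fun l => zakTerm l f) (zak f) := hasSum_zakLin f
  have hsum' : HasSum (fun l => zakTerm l g) (zak g) := hasSum_zakLin g
  have h2 := (M ∘L τ).hasSum hsum
  have h3 := (P.hasSum hsum').add (Q.hasSum ((Equiv.subRight (1 : ℤ)).hasSum_iff.2 hsum'))
  rw [hPQ] at h3
  have h4 : (M ∘L τ) (zak f) = zak g := by
    refine h2.unique ?_
    convert h3 using 2 with l
    exact hterm l
  refine AEEqFun.ext ((EventuallyEq.of_eq ?_).trans ((hτ (zak f)).trans (shiftAE_coeFn s _).symm))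
  rw [zakAE_coeFn, ← h4]; rfl

/-- The operator `f ↦ ∑_{j<a} G_j · Z(ρ(-j/a,0,1) f)`. -/
def symMap (a : ℕ) (G : ℕ → ZakFun) : H →ₗ[ℂ] ZakFun :=
  ∑ j ∈ Finset.range a, mulAE (G j) ∘ₗ zakAE ∘ₗ (rhoOp (-(j : ℝ) / a, 0) : H →ₗ[ℂ] H)

lemma symMap_apply (a : ℕ) (G : ℕ → ZakFun) (f : H) :
    symMap a G f = ∑ j ∈ Finset.range a, G j * zakAE (rhoOp (-(j : ℝ) / a, 0) f) := by
  simp [symMap, LinearMap.sum_apply]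

lemma symMap_sum {ι : Type*} (a : ℕ) (s : Finset ι) (G : ι → ℕ → ZakFun) :
    symMap a (fun j => ∑ i ∈ s, G i j) = ∑ i ∈ s, symMap a (G i) := by
  ext1 f
  simp only [symMap_apply, LinearMap.sum_apply, Finset.sum_mul]
  exact Finset.sum_comm

/-- Invariance under the shifts `(θ, σ) ↦ (θ, σ - j/a)` of the torus. -/
def IsShiftInvariant {E : Type*} (a : ℕ) (b : ℝ × ℝ → E) : Prop :=
  ∀ j < a, ∀ w ∈ Ω, b (torusShift ((j : ℝ) / a) w) = b w

lemma zakAE_rhoOp_shift {a j : ℕ} (hj : j < a) (f : H) :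
    zakAE (rhoOp (-(j : ℝ) / a, 0) f) = shiftAE ((j : ℝ) / a) (zakAE f) := by
  rw [neg_div]
  have ha : (0 : ℝ) < a := by exact_mod_cast (Nat.zero_le j).trans_lt hj
  refine zakAE_translate (by positivity) ?_ f
  rw [div_lt_one ha]; exact_mod_cast hj

lemma symMap_mul {a : ℕ} (G : ℕ → ZakFun) {β : ZakFun} {b : ℝ × ℝ → ℂ}
    (hb : β =ᵐ[volume.restrict Ω] b) (hinv : IsShiftInvariant a b) {f g : H}
    (hg : zakAE g = β * zakAE f) : symMap a G g = β * symMap a G f := by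
  simp only [symMap_apply, Finset.mul_sum]
  refine Finset.sum_congr rfl fun j hj => ?_
  have hj' := Finset.mem_range.1 hj
  rw [zakAE_rhoOp_shift hj', zakAE_rhoOp_shift hj', hg, shiftAE_mul _ hb (hinv j hj')]
  ring

lemma norm_rhoOp (w : ℝ × ℝ) (f : H) : ‖rhoOp w f‖ = ‖f‖ := (rho w.1 w.2 1).norm_map f

/-- Bounded symbols define bounded operators. -/
lemma exists_bounded_of_symbol {a : ℕ} {G : ℕ → ZakFun} {C : ℝ}
    (hG : ∀ j < a, ∀ᵐ w ∂(volume.restrict Ω : Measure (ℝ × ℝ)), ‖G j w‖ ≤ C) :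
    ∃ B : H →L[ℂ] H, (∀ f, zakAE (B f) = symMap a G f) ∧ ∀ f, ‖B f‖ ≤ a * C * ‖f‖ := by
  have h : ∀ j, ∃ M : H →L[ℂ] H, j < a → (∀ f, zakAE (M f) = G j * zakAE f) ∧
      ∀ f, ‖M f‖ ≤ C * ‖f‖ := by
    intro j
    by_cases hj : j < a
    · obtain ⟨M, hM, hM'⟩ := exists_mulOp (G j).aestronglyMeasurable (hG j hj)
      exact ⟨M, fun _ => ⟨fun f => by rw [hM, AEEqFun.mk_coeFn], hM'⟩⟩
    · exact ⟨0, fun h => absurd h hj⟩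
  choose M hM using h
  refine ⟨∑ j ∈ Finset.range a, M j ∘L rhoOp (-(j : ℝ) / a, 0), fun f => ?_, fun f => ?_⟩
  · rw [symMap_apply, sum_apply, map_sum]
    refine Finset.sum_congr rfl fun j hj => ?_
    rw [ContinuousLinearMap.comp_apply, (hM j (Finset.mem_range.1 hj)).1]
  · rw [sum_apply]
    refine (norm_sum_le _ _).trans ((Finset.sum_le_sum fun j hj =>
      (hM j (Finset.mem_range.1 hj)).2 _).trans ?_)
    simp [norm_rhoOp, mul_assoc]

/-- The class of an indicator function. -/
def indAE {S : Set (ℝ × ℝ)} (hS : MeasurableSet S) : ZakFun :=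
  AEEqFun.mk (S.indicator 1) (aestronglyMeasurable_one.indicator hS)

lemma indAE_coeFn {S : Set (ℝ × ℝ)} (hS : MeasurableSet S) :
    indAE hS =ᵐ[volume.restrict Ω] S.indicator (1 : ℝ × ℝ → ℂ) := AEEqFun.coeFn_mk _ _

lemma indAE_mul_coeFn {S : Set (ℝ × ℝ)} (hS : MeasurableSet S) (F : ZakFun) :
    (indAE hS * F : ZakFun) =ᵐ[volume.restrict Ω] S.indicator F := by
  filter_upwards [AEEqFun.coeFn_mul (indAE hS) F, indAE_coeFn hS] with w h1 h2
  rw [h1, Pi.mul_apply, h2]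
  by_cases h : w ∈ S <;> simp [h]

lemma indAE_mul_self {S : Set (ℝ × ℝ)} (hS : MeasurableSet S) : indAE hS * indAE hS = indAE hS := by
  refine AEEqFun.ext ?_
  filter_upwards [indAE_mul_coeFn hS (indAE hS), indAE_coeFn hS] with w h1 h2
  rw [h1]
  by_cases h : w ∈ S
  · rw [indicator_of_mem h]
  · rw [indicator_of_notMem h, h2, indicator_of_notMem h]

/-- The restriction of the Zak transform to a set, as an operator on `L²(ℝ)`. -/
lemma exists_cutOp {S : Set (ℝ × ℝ)} (hS : MeasurableSet S) :
    ∃ M : H →L[ℂ] H, ∀ f, zakAE (M f) = indAE hS * zakAE f := by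
  obtain ⟨M, hM, -⟩ := exists_mulOp (b := S.indicator 1)
    (aestronglyMeasurable_one.indicator hS) (C := 1) (ae_of_all _ fun w => by
      by_cases h : w ∈ S <;> simp [h])
  exact ⟨M, hM⟩

/-- The operator `Z⁻¹ 1_S Z`. -/
def cutOp {S : Set (ℝ × ℝ)} (hS : MeasurableSet S) : H →L[ℂ] H := (exists_cutOp hS).choose

lemma zakAE_cutOp {S : Set (ℝ × ℝ)} (hS : MeasurableSet S) (f : H) :
    zakAE (cutOp hS f) = indAE hS * zakAE f := (exists_cutOp hS).choose_spec f

lemma zak_cutOp {S : Set (ℝ × ℝ)} (hS : MeasurableSet S) (f : H) :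
    zak (cutOp hS f) =ᵐ[volume.restrict Ω] S.indicator (zak f) := by
  refine (EventuallyEq.of_eq ?_).trans (indAE_mul_coeFn hS (zakAE f))
  rw [← zakAE_coeFn, zakAE_cutOp]

lemma isShiftInvariant_indicator {a : ℕ} {S : Set (ℝ × ℝ)}
    (h : IsShiftInvariant a fun w => w ∈ S) : IsShiftInvariant a (S.indicator (1 : ℝ × ℝ → ℂ)) := by
  intro j hj w hw
  have h1 : (torusShift ((j : ℝ) / a) w ∈ S) = (w ∈ S) := h j hj w hw
  by_cases hS : w ∈ S
  · rw [indicator_of_mem hS, indicator_of_mem (h1 ▸ hS)]; rfl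
  · rw [indicator_of_notMem hS, indicator_of_notMem (h1 ▸ hS)]

lemma symMap_cutOp {a : ℕ} (G : ℕ → ZakFun) {S : Set (ℝ × ℝ)} (hS : MeasurableSet S)
    (h : IsShiftInvariant a fun w => w ∈ S) (f : H) :
    symMap a G (cutOp hS f) = indAE hS * symMap a G f :=
  symMap_mul G (indAE_coeFn hS) (isShiftInvariant_indicator h) (zakAE_cutOp hS f)

lemma symMap_indAE_mul {a : ℕ} (G : ℕ → ZakFun) {S : Set (ℝ × ℝ)} (hS : MeasurableSet S) (f : H) :
    symMap a (fun j => indAE hS * G j) f = indAE hS * symMap a G f := by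
  simp only [symMap_apply, Finset.mul_sum, mul_assoc]

/-- The symbol `G` is bounded by the shift-invariant weight `c`. -/
structure IsDominated (a : ℕ) (c : ℝ × ℝ → ℝ) (G : ℕ → ZakFun) : Prop where
  meas : Measurable c
  inv : IsShiftInvariant a c
  le : ∀ j < a, ∀ᵐ w ∂(volume.restrict Ω : Measure (ℝ × ℝ)), ‖G j w‖ ≤ c w

/-- The sublevel set `{c ≤ t}`. -/
def sublevel (c : ℝ × ℝ → ℝ) (t : ℝ) : Set (ℝ × ℝ) := {w | c w ≤ t}

lemma measurableSet_sublevel {c : ℝ × ℝ → ℝ} (hc : Measurable c) (t : ℝ) :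
    MeasurableSet (sublevel c t) := measurableSet_le hc measurable_const

lemma IsShiftInvariant.sublevel {a : ℕ} {c : ℝ × ℝ → ℝ} (hc : IsShiftInvariant a c) (t : ℝ) :
    IsShiftInvariant a fun w => w ∈ sublevel c t := fun j hj w hw => by
  change (c _ ≤ t) = (c w ≤ t); rw [hc j hj w hw]

lemma IsDominated.norm_cut_le {a : ℕ} {c : ℝ × ℝ → ℝ} {G : ℕ → ZakFun} (h : IsDominated a c G)
    {t : ℝ} (ht : 0 ≤ t) : ∀ j < a, ∀ᵐ w ∂(volume.restrict Ω : Measure (ℝ × ℝ)),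
      ‖(indAE (measurableSet_sublevel h.meas t) * G j : ZakFun) w‖ ≤ t := by
  intro j hj
  filter_upwards [indAE_mul_coeFn (measurableSet_sublevel h.meas t) (G j), h.le j hj] with w h1 h2
  rw [h1]
  by_cases hw : w ∈ ZakPeriodization.sublevel c t
  · rw [indicator_of_mem hw]; exact h2.trans hw
  · rw [indicator_of_notMem hw]; simpa using ht

lemma IsDominated.exists_cut {a : ℕ} {c : ℝ × ℝ → ℝ} {G : ℕ → ZakFun} (h : IsDominated a c G)
    {t : ℝ} (ht : 0 ≤ t) : ∃ B : H →L[ℂ] H,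
      (∀ f, zakAE (B f) = indAE (measurableSet_sublevel h.meas t) * symMap a G f) ∧
      ∀ f, ‖B f‖ ≤ a * t * ‖f‖ := by
  obtain ⟨B, hB, hB'⟩ := exists_bounded_of_symbol (h.norm_cut_le ht)
  exact ⟨B, fun f => by rw [hB, symMap_indAE_mul], hB'⟩

lemma eq_of_indAE_sublevel {c : ℝ × ℝ → ℝ} (hc : Measurable c) {F F' : ZakFun}
    (h : ∀ k : ℕ, indAE (measurableSet_sublevel hc k) * F =
      indAE (measurableSet_sublevel hc k) * F') : F = F' := by
  refine AEEqFun.ext ?_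
  filter_upwards [ae_all_iff.2 fun k : ℕ => indAE_mul_coeFn (measurableSet_sublevel hc k) F,
    ae_all_iff.2 fun k : ℕ => indAE_mul_coeFn (measurableSet_sublevel hc k) F'] with w h1 h2
  obtain ⟨k, hk⟩ := exists_nat_ge (c w)
  have hk' : w ∈ sublevel c k := hk
  have h3 := h1 k
  rw [h k, h2 k, indicator_of_mem hk', indicator_of_mem hk'] at h3
  exact h3.symm

lemma tendsto_cutOp {c : ℝ × ℝ → ℝ} (hc : Measurable c) (f : H) :
    Tendsto (fun k : ℕ => cutOp (measurableSet_sublevel hc k) f) atTop (𝓝 f) := by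
  rw [tendsto_iff_norm_sub_tendsto_zero]
  have key : ∀ k : ℕ, ((‖cutOp (measurableSet_sublevel hc k) f - f‖ ^ 2 : ℝ) : ℂ) =
      ∫ w in Ω, (((sublevel c k)ᶜ.indicator (fun w => ‖zak f w‖ ^ 2) w : ℝ) : ℂ) := by
    intro k
    rw [← zak.norm_map, map_sub]
    have h1 := inner_self_eq_norm_sq_to_K (𝕜 := ℂ)
      (zak (cutOp (measurableSet_sublevel hc k) f) - zak f)
    rw [Complex.ofReal_pow]
    refine h1.symm.trans ?_
    rw [L2.inner_def]
    refine integral_congr_ae ?_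
    filter_upwards [zak_cutOp (measurableSet_sublevel hc k) f,
      Lp.coeFn_sub (zak (cutOp (measurableSet_sublevel hc k) f)) (zak f)]
      with w h3 h4
    rw [h4, Pi.sub_apply, h3, inner_self_eq_norm_sq_to_K]
    by_cases hw : w ∈ sublevel c k
    · simp [hw]
    · simp [hw]
  have hint : Integrable (fun w => ‖zak f w‖ ^ 2) (volume.restrict Ω) :=
    (memLp_two_iff_integrable_sq_norm (Lp.memLp (zak f)).1).1 (Lp.memLp (zak f))
  have hlim : Tendsto (fun k : ℕ => ((‖cutOp (measurableSet_sublevel hc k) f - f‖ ^ 2 : ℝ) : ℂ))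
      atTop (𝓝 0) := by
    simp_rw [key]
    rw [← integral_zero (ℝ × ℝ) ℂ (μ := volume.restrict Ω)]
    refine tendsto_integral_of_dominated_convergence (fun w => ‖zak f w‖ ^ 2) (fun k => ?_) hint
      (fun k => ae_of_all _ fun w => ?_) (ae_of_all _ fun w => ?_)
    · exact Complex.continuous_ofReal.comp_aestronglyMeasurable
        (hint.1.indicator (measurableSet_sublevel hc k).compl)
    · by_cases hw : w ∈ sublevel c k <;> simp [hw]
    · obtain ⟨m, hm⟩ := exists_nat_ge (c w)
      refine tendsto_const_nhds.congr' ?_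
      filter_upwards [eventually_ge_atTop m] with k hk
      have hw : w ∈ sublevel c k := hm.trans (by exact_mod_cast hk)
      simp [hw]
  have h3 := (Complex.continuous_re.tendsto _).comp hlim
  have h4 := (Real.continuous_sqrt.tendsto _).comp h3
  simpa [Function.comp_def, ← Complex.ofReal_pow, Real.sqrt_sq (norm_nonneg _)] using h4

section operators

variable {a : ℕ} {c : ℝ × ℝ → ℝ} {G : ℕ → ZakFun}

lemma IsDominated.isClosed (h : IsDominated a c G) : (zakOp (symMap a G)).IsClosed := by
  choose B hB _ using fun k : ℕ => h.exists_cut (Nat.cast_nonneg k)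
  have : ((zakOp (symMap a G)).graph : Set (H × H)) =
      ⋂ k : ℕ, {x | cutOp (measurableSet_sublevel h.meas k) x.2 = B k x.1} := by
    ext ⟨f, g⟩
    rw [SetLike.mem_coe, mem_graph_zakOp, mem_iInter]
    constructor
    · intro hfg k
      apply zakAE_injective
      rw [zakAE_cutOp, hB, hfg]
    · intro hk
      refine eq_of_indAE_sublevel h.meas fun k => ?_
      have h2 : cutOp (measurableSet_sublevel h.meas k) g = B k f := hk k
      rw [← zakAE_cutOp, ← hB, h2]
  rw [LinearPMap.IsClosed, this]
  exact isClosed_iInter fun k => isClosed_eq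
    ((cutOp _).continuous.comp continuous_snd) ((B k).continuous.comp continuous_fst)

lemma IsDominated.cutOp_mem_domain (h : IsDominated a c G) (k : ℕ) (f : H) :
    cutOp (measurableSet_sublevel h.meas k) f ∈ (zakOp (symMap a G)).domain := by
  obtain ⟨B, hB, -⟩ := h.exists_cut (Nat.cast_nonneg k)
  exact mem_domain_zakOp.2 ⟨B f, by rw [hB, symMap_cutOp G _ (h.inv.sublevel k)]⟩

lemma IsDominated.dense_domain (h : IsDominated a c G) :
    Dense ((zakOp (symMap a G)).domain : Set H) := fun f =>
  mem_closure_of_tendsto (tendsto_cutOp h.meas f)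
    (Eventually.of_forall fun k => h.cutOp_mem_domain k f)

lemma mem_graph_sum_zakOp {ι : Type*} (s : Finset ι) (L : ι → H →ₗ[ℂ] ZakFun) {f g : H} :
    (f, g) ∈ (∑ i ∈ s, zakOp (L i)).graph ↔
      (∀ i ∈ s, f ∈ (zakOp (L i)).domain) ∧ zakAE g = ∑ i ∈ s, L i f := by
  classical
  induction s using Finset.induction_on generalizing g with
  | empty =>
    simp only [Finset.sum_empty, LinearPMap.mem_graph_iff]
    constructor
    · rintro ⟨y, rfl, rfl⟩; simp
    · rintro ⟨-, h⟩
      refine ⟨⟨f, Submodule.mem_top⟩, rfl, zakAE_injective ?_⟩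
      rw [h]; exact map_zero _
  | insert i s hi ih =>
    rw [Finset.sum_insert hi, Finset.sum_insert hi]
    constructor
    · rw [LinearPMap.mem_graph_iff]
      rintro ⟨⟨y, hyd⟩, rfl, rfl⟩
      have hy : y ∈ (zakOp (L i)).domain ⊓ (∑ i ∈ s, zakOp (L i)).domain := hyd
      have h2 := ih.1 (LinearPMap.mem_graph _ ⟨y, hy.2⟩)
      refine ⟨Finset.forall_mem_insert _ _ _ |>.2 ⟨hy.1, h2.1⟩, ?_⟩
      change zakAE (zakOp (L i) ⟨y, hy.1⟩ + (∑ i ∈ s, zakOp (L i)) ⟨y, hy.2⟩) = _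
      rw [map_add, zakAE_zakOp, h2.2]
    · rintro ⟨hd, hg⟩
      rw [Finset.forall_mem_insert] at hd
      have h1 := zakAE_zakOp (L i) ⟨f, hd.1⟩
      have h2 : (f, g - zakOp (L i) ⟨f, hd.1⟩) ∈ (∑ i ∈ s, zakOp (L i)).graph :=
        ih.2 ⟨hd.2, by rw [map_sub, h1, hg]; simp⟩
      obtain ⟨y, hy, hy'⟩ := (LinearPMap.mem_graph_iff _).1 h2
      have hy0 : (y : H) = f := hy
      subst hy0
      refine (LinearPMap.mem_graph_iff _).2 ⟨⟨y, ?_⟩, rfl, ?_⟩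
      · rw [LinearPMap.add_domain]; exact ⟨hd.1, y.2⟩
      · change zakOp (L i) ⟨y, hd.1⟩ + (∑ i ∈ s, zakOp (L i)) y = g
        rw [hy']; exact add_sub_cancel _ _

/-- The strong sum of operators with symbols dominated by a common weight. -/
lemma strongSum_zakOp {n : ℕ} {c : ℝ × ℝ → ℝ} {G : Fin n → ℕ → ZakFun}
    (h : ∀ i, IsDominated a c (G i)) (hs : IsDominated a c fun j => ∑ i, G i j) :
    strongSum (fun i => zakOp (symMap a (G i))) = zakOp (symMap a fun j => ∑ i, G i j) := by
  set S := ∑ i, zakOp (symMap a (G i)) with hS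
  set T := zakOp (symMap a fun j => ∑ i, G i j) with hT
  have hle : S ≤ T := by
    refine LinearPMap.le_of_le_graph ?_
    rintro ⟨f, g⟩ hfg
    rw [hS, mem_graph_sum_zakOp] at hfg
    rw [hT, mem_graph_zakOp, hfg.2, symMap_sum, LinearMap.sum_apply]
  have hcl : S.IsClosable := hs.isClosed.isClosable.leIsClosable hle
  refine LinearPMap.eq_of_eq_graph ?_
  change S.closure.graph = T.graph
  rw [← hcl.graph_closure_eq_closure_graph]
  refine le_antisymm ?_ ?_
  · exact Submodule.topologicalClosure_minimal _ (LinearPMap.le_graph_of_le hle) hs.isClosed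
  · rintro ⟨f, g⟩ hfg
    rw [hT, mem_graph_zakOp] at hfg
    change (f, g) ∈ closure (S.graph : Set (H × H))
    refine mem_closure_of_tendsto
      ((tendsto_cutOp hs.meas f).prodMk_nhds (tendsto_cutOp hs.meas g))
      (Eventually.of_forall fun k => ?_)
    rw [SetLike.mem_coe, hS, mem_graph_sum_zakOp]
    refine ⟨fun i _ => (h i).cutOp_mem_domain k f, ?_⟩
    rw [zakAE_cutOp, hfg, ← symMap_cutOp _ _ (hs.inv.sublevel k), symMap_sum, LinearMap.sum_apply]

end operators

lemma rhoOp_rhoInv (n : ℝ × ℝ) (f : H) : rhoOp n (rhoInv n f) = f :=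
  (rho n.1 n.2 1).apply_symm_apply f

lemma phase_mul_neg (t : ℝ) : phase (-t) * phase t = 1 := by
  rw [← phase_add, neg_add_cancel, phase_zero]

/-- On the Zak side `ρ(n,1)`, `n ∈ N`, is multiplication by a shift-invariant unimodular function. -/
lemma exists_symbol_of_mem_lattice (a : ℕ) {n : ℝ × ℝ} (hn : n ∈ lattice a) :
    ∃ (b : ℝ × ℝ → ℂ) (β β' : ZakFun), β =ᵐ[volume.restrict Ω] b ∧ IsShiftInvariant a b ∧
      β' * β = 1 ∧ ∀ f, zakAE (rhoOp n f) = β * zakAE f := by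
  obtain ⟨k, l, rfl⟩ := hn
  set q : ℤ := a * l with hq
  let u : ℝ × ℝ → ℝ := fun w => k * q / 2 + q * w.2 + k * w.1
  have hu : Continuous u := by fun_prop
  have hc : Continuous fun w => phase (u w) := continuous_phase.comp hu
  have hc' : Continuous fun w => phase (-u w) := continuous_phase.comp hu.neg
  refine ⟨fun w => phase (u w), AEEqFun.mk _ hc.aestronglyMeasurable,
    AEEqFun.mk _ hc'.aestronglyMeasurable, AEEqFun.coeFn_mk _ _, fun j hj w _ => ?_, ?_, fun f => ?_⟩
  · have ha : (a : ℝ) ≠ 0 := by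
      have : a ≠ 0 := by omega
      exact_mod_cast this
    have e : u (torusShift ((j : ℝ) / a) w) =
        u w + ((-(l * j) - q * ⌊w.2 - (j : ℝ) / a⌋ : ℤ) : ℝ) := by
      simp only [u, torusShift, Int.fract, hq]
      push_cast
      field_simp
      ring
    change phase (u _) = phase (u w)
    rw [e, phase_add, phase_intCast, mul_one]
  · rw [AEEqFun.mk_mul_mk, AEEqFun.one_def, AEEqFun.mk_eq_mk]
    exact ae_of_all _ fun w => phase_mul_neg (u w)
  · have e : ((k : ℝ), (a : ℝ) * l) = ((k : ℝ), (q : ℝ)) := by rw [hq]; push_cast; rfl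
    rw [e]
    refine AEEqFun.ext ((zak_rhoOp_int k q f).trans ?_)
    filter_upwards [AEEqFun.coeFn_mul (AEEqFun.mk _ hc.aestronglyMeasurable) (zakAE f),
      AEEqFun.coeFn_mk _ hc.aestronglyMeasurable (μ := volume.restrict Ω)] with w h1 h2
    rw [h1, Pi.mul_apply, h2]; rfl

lemma symMap_rhoOp {a : ℕ} (G : ℕ → ZakFun) {n : ℝ × ℝ} {b : ℝ × ℝ → ℂ} {β : ZakFun}
    (hb : β =ᵐ[volume.restrict Ω] b) (hinv : IsShiftInvariant a b)
    (hβ : ∀ f, zakAE (rhoOp n f) = β * zakAE f) (f : H) :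
    symMap a G f = β * symMap a G (rhoInv n f) := by
  conv_lhs => rw [← rhoOp_rhoInv n f]
  exact symMap_mul G hb hinv (hβ _)

lemma isPeriodic_zakOp (a : ℕ) (G : ℕ → ZakFun) : IsPeriodic a (zakOp (symMap a G)) := by
  intro n hn
  obtain ⟨b, β, β', hb, hinv, hββ, hβ⟩ := exists_symbol_of_mem_lattice a hn
  refine LinearPMap.eq_of_eq_graph (Submodule.ext fun ⟨f, g⟩ => ?_)
  simp only [mem_graph_compLeft, mem_graph_compRight, mem_graph_zakOp]
  rw [symMap_rhoOp G hb hinv hβ f]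
  constructor
  · rintro ⟨g', h1, rfl⟩
    rw [hβ, h1]
  · intro h
    refine ⟨rhoInv n g, ?_, rhoOp_rhoInv n g⟩
    rw [← rhoOp_rhoInv n g, hβ] at h
    have h2 := congrArg (β' * ·) h
    simpa only [← mul_assoc, hββ, one_mul] using h2

lemma mem_algA_of_symbol {a : ℕ} {G : ℕ → ZakFun} {B : H →L[ℂ] H}
    (hB : ∀ f, zakAE (B f) = symMap a G f) : B ∈ algA a := by
  intro n hn
  obtain ⟨b, β, β', hb, hinv, hββ, hβ⟩ := exists_symbol_of_mem_lattice a hn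
  refine ContinuousLinearMap.ext fun f => zakAE_injective ?_
  simp only [ContinuousLinearMap.comp_apply]
  rw [hβ, hB, hB, symMap_rhoOp G hb hinv hβ f]

lemma rhoOp_zero : rhoOp 0 = ContinuousLinearMap.id ℂ H := by
  refine ContinuousLinearMap.ext fun f => Lp.ext ((rhoOp_coeFn 0 f).trans ?_)
  exact ae_of_all _ fun t => by simp

lemma symMap_single {a : ℕ} (ha : 0 < a) (β : ZakFun) (f : H) :
    symMap a (Pi.single 0 β) f = β * zakAE f := by
  rw [symMap_apply, Finset.sum_eq_single_of_mem 0 (Finset.mem_range.2 ha)]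
  · have : ((-((0 : ℕ) : ℝ) / a, 0) : ℝ × ℝ) = 0 := by simp
    rw [this, rhoOp_zero, Pi.single_eq_same]; rfl
  · intro j _ hj
    rw [Pi.single_eq_of_ne hj, zero_mul]

/-- The strip `{(θ, σ) | h/a ≤ σ < (h+1)/a}`. -/
def strip (a h : ℕ) : Set (ℝ × ℝ) := {w | w.2 ∈ Ico ((h : ℝ) / a) (((h : ℝ) + 1) / a)}

lemma zakAE_chi {a h : ℕ} (hh : h < a) :
    zakAE (chi a h) =ᵐ[volume.restrict Ω] (strip a h).indicator 1 := by
  have ha : (0 : ℝ) < a := by exact_mod_cast (Nat.zero_le h).trans_lt hh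
  have hχ : chi a h =ᵐ[volume] (Ico ((h : ℝ) / a) (((h : ℝ) + 1) / a)).indicator fun _ => (1 : ℂ) :=
    indicatorConstLp_coeFn
  have h1 : (zak (chi a h) : L2Ω) = zakTerm 0 (chi a h) := by
    refine zakLin_eq_zakTerm 0 (chi a h) ?_
    filter_upwards [hχ] with t ht hn
    rw [ht, indicator_of_notMem]
    rintro ⟨h1, h2⟩
    apply hn
    have h3 : ((h : ℝ) + 1) / a ≤ 1 := by
      rw [div_le_one ha]; exact_mod_cast hh
    have h4 : (0 : ℝ) ≤ h / a := by positivity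
    simp only [Int.cast_zero, neg_zero, zero_add]
    exact ⟨h4.trans h1, h2.trans_le h3⟩
  rw [zakAE_coeFn, h1]
  filter_upwards [zakTerm_coeFn 0 (chi a h), ae_Ω_of_ae hχ 0] with w h2 h3
  rw [h2, zakTermFun, h3]
  simp only [Int.cast_zero, zero_mul, phase_zero, one_mul, sub_zero]
  rfl

lemma torusShift_notMem_strip {a h j : ℕ} (hj : j < a) (hj0 : j ≠ 0) {w : ℝ × ℝ}
    (hw : w ∈ strip a h) : torusShift ((j : ℝ) / a) w ∉ strip a h := by
  have ha : (0 : ℝ) < a := by exact_mod_cast (Nat.zero_le j).trans_lt hj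
  rintro ⟨h1, h2⟩
  obtain ⟨h3, h4⟩ := hw
  simp only [torusShift, Int.fract] at h1 h2
  set m := ⌊w.2 - (j : ℝ) / a⌋
  have e1 : ((j : ℝ) + a * m) = a * (w.2 - (w.2 - j / a - m)) := by field_simp; ring
  rw [div_le_iff₀ ha] at h1 h3
  rw [lt_div_iff₀ ha] at h2 h4
  have l1 : (j : ℝ) + a * m < 1 := by rw [e1]; linarith
  have l2 : (-1 : ℝ) < (j : ℝ) + a * m := by rw [e1]; linarith
  have l1' : (j : ℤ) + a * m < 1 := by exact_mod_cast l1
  have l2' : -1 < (j : ℤ) + a * m := by exact_mod_cast l2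
  have e : (j : ℤ) = a * (-m) := by linarith
  have : (a : ℤ) ∣ j := ⟨-m, e⟩
  have := Nat.le_of_dvd (Nat.pos_of_ne_zero hj0) (Int.natCast_dvd_natCast.1 this)
  omega

lemma symMap_chi {a h : ℕ} (hh : h < a) (G : ℕ → ZakFun) :
    ∀ᵐ w ∂(volume.restrict Ω : Measure (ℝ × ℝ)), w ∈ strip a h →
      symMap a G (chi a h) w = G 0 w := by
  have key : ∀ j < a, ∀ᵐ w ∂(volume.restrict Ω : Measure (ℝ × ℝ)), w ∈ strip a h →
      (G j * zakAE (rhoOp (-(j : ℝ) / a, 0) (chi a h)) : ZakFun) w = if j = 0 then G 0 w else 0 := by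
    intro j hj
    filter_upwards [AEEqFun.coeFn_mul (G j) (zakAE (rhoOp (-(j : ℝ) / a, 0) (chi a h))),
      EventuallyEq.of_eq (congrArg (fun F : ZakFun => (F : ℝ × ℝ → ℂ))
        (zakAE_rhoOp_shift hj (chi a h))), shiftAE_coeFn ((j : ℝ) / a) (zakAE (chi a h)),
      ae_torusShift ((j : ℝ) / a) (zakAE_chi hh), ae_mem_Ω] with w h1 h2 h3 h4 hΩ hw
    rw [h1, Pi.mul_apply, h2, h3, h4]
    split_ifs with h0
    · subst h0
      have hfl : ⌊w.2⌋ = 0 := Int.floor_eq_zero_iff.2 hΩ.2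
      have : torusShift (((0 : ℕ) : ℝ) / a) w = w := by
        simp only [torusShift, Nat.cast_zero, zero_div, sub_zero]
        rw [Int.fract_eq_self.2 hΩ.2]
      rw [this, indicator_of_mem hw]
      simp [hfl]
    · rw [indicator_of_notMem (torusShift_notMem_strip hj h0 hw), mul_zero, mul_zero]
  have hall : ∀ᵐ w ∂(volume.restrict Ω : Measure (ℝ × ℝ)), ∀ j ∈ Finset.range a, w ∈ strip a h →
      (G j * zakAE (rhoOp (-(j : ℝ) / a, 0) (chi a h)) : ZakFun) w = if j = 0 then G 0 w else 0 :=
    (Finset.eventually_all (Finset.range a)).2 fun j hj => key j (Finset.mem_range.1 hj)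
  filter_upwards [hall, AEEqFun.coeFn_fun_finsetSum (s := Finset.range a) fun j =>
    G j * zakAE (rhoOp (-(j : ℝ) / a, 0) (chi a h))] with w h1 h2 hw
  rw [symMap_apply, h2, Finset.sum_congr rfl fun j hj => h1 j hj hw]
  rw [Finset.sum_ite_eq' (Finset.range a) 0 fun _ => G 0 w, if_pos]
  exact Finset.mem_range.2 ((Nat.zero_le h).trans_lt hh)

lemma sum_indicator_strip {a : ℕ} (ha : 0 < a) {w : ℝ × ℝ} (hw : w ∈ Ω) (x : ℂ) :
    ∑ h ∈ Finset.range a, (strip a h).indicator (fun _ => x) w = x := by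
  have ha' : (0 : ℝ) < a := by exact_mod_cast ha
  have hmem : ∀ h : ℕ, w ∈ strip a h ↔ ⌊w.2 * a⌋₊ = h := by
    intro h
    rw [Nat.floor_eq_iff (mul_nonneg hw.2.1 ha'.le), ← div_le_iff₀ ha', ← lt_div_iff₀ ha']
    rfl
  have hlt : ⌊w.2 * a⌋₊ < a := by
    rw [Nat.floor_lt (mul_nonneg hw.2.1 ha'.le)]
    nlinarith [hw.2.2]
  rw [Finset.sum_eq_single_of_mem ⌊w.2 * a⌋₊ (Finset.mem_range.2 hlt)]
  · rw [indicator_of_mem ((hmem _).2 rfl)]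
  · intro h _ hne
    rw [indicator_of_notMem fun hm => hne ((hmem h).1 hm).symm]

/-- The trace of a bounded operator with symbol `G` is the integral of `G₀`. -/
lemma tau_of_symbol {a : ℕ} (ha : 0 < a) {G : ℕ → ZakFun} {B : H →L[ℂ] H}
    (hB : ∀ f, zakAE (B f) = symMap a G f) : tau a B = ∫ w in Ω, G 0 w := by
  have h1 : ∀ h ∈ Finset.range a, ⟪chi a h, B (chi a h)⟫_ℂ =
      ∫ w in Ω, ⟪zak (chi a h) w, zak (B (chi a h)) w⟫_ℂ := fun h _ => by
    rw [← zak.inner_map_map, L2.inner_def]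
  rw [tau, Finset.sum_congr rfl h1, ← integral_finsetSum _ fun h _ => L2.integrable_inner _ _]
  refine integral_congr_ae ?_
  have h2 : ∀ᵐ w ∂(volume.restrict Ω : Measure (ℝ × ℝ)), ∀ h ∈ Finset.range a,
      ⟪zak (chi a h) w, zak (B (chi a h)) w⟫_ℂ = (strip a h).indicator (fun _ => G 0 w) w := by
    refine (Finset.eventually_all (Finset.range a)).2 fun h hh => ?_
    have hh' := Finset.mem_range.1 hh
    filter_upwards [zakAE_chi hh', symMap_chi hh' G, EventuallyEq.of_eq
      (congrArg (fun F : ZakFun => (F : ℝ × ℝ → ℂ)) (hB (chi a h)))] with w h3 h4 h5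
    rw [← zakAE_coeFn, ← zakAE_coeFn, h3, h5]
    by_cases hw : w ∈ strip a h
    · rw [h4 hw, indicator_of_mem hw, indicator_of_mem hw]; simp
    · rw [indicator_of_notMem hw, indicator_of_notMem hw, inner_zero_left]
  filter_upwards [h2, ae_mem_Ω] with w h3 hw
  rw [Finset.sum_congr rfl h3, sum_indicator_strip ha hw]

lemma isStarProjection_cutOp {S : Set (ℝ × ℝ)} (hS : MeasurableSet S) :
    IsStarProjection (cutOp hS) := by
  refine ⟨ContinuousLinearMap.ext fun f => zakAE_injective ?_, ?_⟩
  · change zakAE (cutOp hS (cutOp hS f)) = _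
    rw [zakAE_cutOp, zakAE_cutOp, ← mul_assoc, indAE_mul_self]
  · rw [ContinuousLinearMap.isSelfAdjoint_iff_isSymmetric]
    intro f g
    change ⟪cutOp hS f, g⟫_ℂ = ⟪f, cutOp hS g⟫_ℂ
    rw [← zak.inner_map_map, ← zak.inner_map_map, L2.inner_def, L2.inner_def]
    refine integral_congr_ae ?_
    filter_upwards [zak_cutOp hS f, zak_cutOp hS g] with w h1 h2
    rw [h1, h2]
    by_cases hw : w ∈ S <;> simp [hw]

lemma indAE_compl {S : Set (ℝ × ℝ)} (hS : MeasurableSet S) : indAE hS.compl = 1 - indAE hS := by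
  refine AEEqFun.ext ?_
  filter_upwards [indAE_coeFn hS, indAE_coeFn hS.compl, AEEqFun.coeFn_sub 1 (indAE hS),
    AEEqFun.coeFn_one (α := ℝ × ℝ) (β := ℂ) (μ := volume.restrict Ω)] with w h1 h2 h3 h4
  rw [h2, h3, Pi.sub_apply, h1, h4]
  by_cases hw : w ∈ S <;> simp [hw]

lemma cutOp_mem_algA {a : ℕ} (ha : 0 < a) {S : Set (ℝ × ℝ)} (hS : MeasurableSet S) :
    cutOp hS ∈ algA a :=
  mem_algA_of_symbol (G := Pi.single 0 (indAE hS)) fun f => by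
    rw [symMap_single ha, zakAE_cutOp]

lemma tau_one_sub_cutOp {a : ℕ} (ha : 0 < a) {S : Set (ℝ × ℝ)} (hS : MeasurableSet S) :
    ENNReal.ofReal (tau a (1 - cutOp hS)).re = volume.restrict Ω Sᶜ := by
  have h : ∀ f, zakAE ((1 - cutOp hS) f) = symMap a (Pi.single 0 (indAE hS.compl)) f := by
    intro f
    rw [symMap_single ha, indAE_compl, sub_mul, one_mul, ← zakAE_cutOp]
    exact map_sub zakAE f (cutOp hS f)
  have h2 : ∫ w in Ω, (Pi.single 0 (indAE hS.compl) : ℕ → ZakFun) 0 w =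
      ∫ w in Ω, Sᶜ.indicator 1 w := by
    rw [Pi.single_eq_same]
    exact integral_congr_ae (indAE_coeFn hS.compl)
  rw [tau_of_symbol ha h, h2, integral_indicator hS.compl]
  simp [Measure.real]

lemma IsDominated.distribution_le {a : ℕ} (ha : 0 < a) {c : ℝ × ℝ → ℝ} {G : ℕ → ZakFun}
    (h : IsDominated a c G) {t : ℝ} (ht : 0 < t) :
    distribution a (zakOp (symMap a G)) t ≤ volume.restrict Ω {w | t < a * c w} := by
  have ha' : (0 : ℝ) < a := by exact_mod_cast ha
  have hm := measurableSet_sublevel h.meas (t / a)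
  obtain ⟨B, hB, hB'⟩ := h.exists_cut (t := t / a) (by positivity)
  have hp : cutOp hm ∈ {p : H →L[ℂ] H | p ∈ algA a ∧ IsStarProjection p ∧
      ∀ f : H, ∃ hf : p f ∈ (zakOp (symMap a G)).domain,
        ‖zakOp (symMap a G) ⟨p f, hf⟩‖ ≤ t * ‖f‖} := by
    refine ⟨cutOp_mem_algA ha hm, isStarProjection_cutOp hm, fun f => ?_⟩
    have h1 : zakAE (B f) = symMap a G (cutOp hm f) := by
      rw [hB, symMap_cutOp G _ (h.inv.sublevel _)]
    refine ⟨mem_domain_zakOp.2 ⟨B f, h1⟩, ?_⟩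
    have h2 : zakOp (symMap a G) ⟨cutOp hm f, mem_domain_zakOp.2 ⟨B f, h1⟩⟩ = B f :=
      zakAE_injective (by rw [zakAE_zakOp, h1])
    rw [h2]
    refine (hB' f).trans (le_of_eq ?_)
    field_simp
  refine (iInf₂_le (cutOp hm) hp).trans (le_of_eq ?_)
  rw [tau_one_sub_cutOp ha hm]
  congr 1
  ext w
  change ¬ (c w ≤ t / a) ↔ t < a * c w
  rw [not_le, div_lt_iff₀ ha', mul_comm]

lemma IsDominated.oneNorm_le {a : ℕ} (ha : 0 < a) {c : ℝ × ℝ → ℝ} {G : ℕ → ZakFun}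
    (h : IsDominated a c G) :
    oneNorm a (zakOp (symMap a G)) ≤ ∫⁻ w in Ω, ENNReal.ofReal (a * c w) := by
  rw [lintegral_eq_lintegral_meas_lt (volume.restrict Ω) ?_ (h.meas.const_mul _).aemeasurable]
  · exact setLIntegral_mono' measurableSet_Ioi fun t ht => h.distribution_le ha ht
  · filter_upwards [h.le 0 ha] with w hw
    exact mul_nonneg (Nat.cast_nonneg _) ((norm_nonneg _).trans hw)

lemma lintegral_weight_lt_top {a : ℕ} {c : ℝ × ℝ → ℝ} (hc : Integrable c (volume.restrict Ω)) :
    ∫⁻ w in Ω, ENNReal.ofReal (a * c w) < ∞ :=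
  (hc.const_mul (a : ℝ)).lintegral_lt_top

/-- The operators with integrable symbol belong to `L¹(A_N, τ)`. -/
lemma IsDominated.memL1 {a : ℕ} (ha : 0 < a) {c : ℝ × ℝ → ℝ} {G : ℕ → ZakFun}
    (h : IsDominated a c G) (hc : Integrable c (volume.restrict Ω)) :
    MemL1 a (zakOp (symMap a G)) :=
  ⟨h.isClosed, h.dense_domain, isPeriodic_zakOp a G,
    (h.oneNorm_le ha).trans_lt (lintegral_weight_lt_top hc)⟩

lemma IsDominated.tail {a : ℕ} {c : ℝ × ℝ → ℝ} {G : ℕ → ZakFun} (h : IsDominated a c G) (t : ℝ) :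
    IsDominated a ((sublevel c t)ᶜ.indicator c)
      fun j => indAE (measurableSet_sublevel h.meas t).compl * G j where
  meas := h.meas.indicator (measurableSet_sublevel h.meas t).compl
  inv j hj w hw := by
    have h1 := h.inv j hj w hw
    have h2 : (torusShift ((j : ℝ) / a) w ∈ ZakPeriodization.sublevel c t) =
        (w ∈ ZakPeriodization.sublevel c t) := h.inv.sublevel t j hj w hw
    by_cases hS : w ∈ ZakPeriodization.sublevel c t
    · rw [indicator_of_notMem (notMem_compl_iff.2 hS),
        indicator_of_notMem (notMem_compl_iff.2 (h2 ▸ hS))]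
    · rw [indicator_of_mem (s := (ZakPeriodization.sublevel c t)ᶜ) hS,
        indicator_of_mem (s := (ZakPeriodization.sublevel c t)ᶜ) (h2 ▸ hS : ¬ _), h1]
  le j hj := by
    filter_upwards [indAE_mul_coeFn (measurableSet_sublevel h.meas t).compl (G j), h.le j hj]
      with w h1 h2
    rw [h1]
    by_cases hw : w ∈ (ZakPeriodization.sublevel c t)ᶜ
    · rw [indicator_of_mem hw, indicator_of_mem hw]; exact h2
    · rw [indicator_of_notMem hw, indicator_of_notMem hw, norm_zero]

/-- The trace of an operator with integrable symbol `G` is the integral of `G₀`. -/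
lemma IsDominated.hasTau {a : ℕ} (ha : 0 < a) {c : ℝ × ℝ → ℝ} {G : ℕ → ZakFun}
    (h : IsDominated a c G) (hc : Integrable c (volume.restrict Ω)) :
    HasTau a (zakOp (symMap a G)) (∫ w in Ω, G 0 w) := by
  choose B hB _ using fun k : ℕ => h.exists_cut (Nat.cast_nonneg k)
  have hm := fun k : ℕ => measurableSet_sublevel h.meas k
  have hB' : ∀ (k : ℕ) f, zakAE (B k f) = symMap a (fun j => indAE (hm k) * G j) f :=
    fun k f => by rw [hB, symMap_indAE_mul]
  refine ⟨h.memL1 ha hc, B, fun k => mem_algA_of_symbol (hB' k), ?_, ?_⟩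
  · have hsub : ∀ k : ℕ, zakOp (symMap a G) - ofBounded (B k) =
        zakOp (symMap a fun j => indAE (hm k).compl * G j) := fun k =>
      zakOp_sub_ofBounded fun f => by
        rw [symMap_indAE_mul, indAE_compl, hB, sub_mul, one_mul]
    have hlim : Tendsto (fun k : ℕ => ∫⁻ w in Ω,
        ENNReal.ofReal (a * (sublevel c k)ᶜ.indicator c w)) atTop (𝓝 0) := by
      rw [← lintegral_zero (μ := volume.restrict Ω)]
      refine tendsto_lintegral_of_dominated_convergence (fun w => ENNReal.ofReal (a * c w))
        (fun k => ?_) (fun k => ?_) (lintegral_weight_lt_top hc).ne (ae_of_all _ fun w => ?_)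
      · exact ((h.tail k).meas.const_mul _).ennreal_ofReal
      · filter_upwards [h.le 0 ha] with w hw
        refine ENNReal.ofReal_le_ofReal (mul_le_mul_of_nonneg_left ?_ (Nat.cast_nonneg _))
        exact indicator_le_self' (fun _ _ => (norm_nonneg _).trans hw) w
      · obtain ⟨m, hm⟩ := exists_nat_ge (c w)
        refine tendsto_const_nhds.congr' ?_
        filter_upwards [eventually_ge_atTop m] with k hk
        have hw : w ∈ sublevel c k := hm.trans (by exact_mod_cast hk)
        simp [hw]
    refine tendsto_of_tendsto_of_tendsto_of_le_of_le tendsto_const_nhds hlim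
      (fun _ => zero_le) fun k => ?_
    change oneNorm a (zakOp (symMap a G) - ofBounded (B k)) ≤ _
    rw [hsub]
    exact (h.tail k).oneNorm_le ha
  · simp_rw [fun k => tau_of_symbol ha (hB' k)]
    refine tendsto_integral_of_dominated_convergence c (fun k => AEEqFun.aestronglyMeasurable _)
      hc (fun k => ?_) ?_
    · filter_upwards [indAE_mul_coeFn (hm k) (G 0), h.le 0 ha] with w h1 h2
      rw [h1]
      exact (norm_indicator_le_norm_self _ _).trans h2
    · filter_upwards [ae_all_iff.2 fun k : ℕ => indAE_mul_coeFn (hm k) (G 0)] with w h1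
      obtain ⟨m, hm'⟩ := exists_nat_ge (c w)
      refine tendsto_const_nhds.congr' ?_
      filter_upwards [eventually_ge_atTop m] with k hk
      have hw : w ∈ sublevel c k := hm'.trans (by exact_mod_cast hk)
      rw [h1, indicator_of_mem hw]

lemma star_add_zakFun (F G : ZakFun) : star (F + G) = star F + star G := by
  refine AEEqFun.ext ?_
  filter_upwards [AEEqFun.coeFn_star (F + G), AEEqFun.coeFn_add F G, AEEqFun.coeFn_star F,
    AEEqFun.coeFn_star G, AEEqFun.coeFn_add (star F) (star G)] with w h1 h2 h3 h4 h5
  simp only [h1, h5, Pi.star_apply, Pi.add_apply, h2, h3, h4, star_add]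

lemma star_smul_zakFun (c : ℂ) (F : ZakFun) : star (c • F) = conj c • star F := by
  refine AEEqFun.ext ?_
  filter_upwards [AEEqFun.coeFn_star (c • F), AEEqFun.coeFn_smul c F, AEEqFun.coeFn_star F,
    AEEqFun.coeFn_smul (conj c) (star F)] with w h1 h2 h3 h4
  simp only [h1, h4, Pi.star_apply, Pi.smul_apply, h2, h3, star_smul]; rfl

lemma star_mul_zakFun (F G : ZakFun) : star (F * G) = star F * star G := by
  refine AEEqFun.ext ?_
  filter_upwards [AEEqFun.coeFn_star (F * G), AEEqFun.coeFn_mul F G, AEEqFun.coeFn_star F,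
    AEEqFun.coeFn_star G, AEEqFun.coeFn_mul (star F) (star G)] with w h1 h2 h3 h4 h5
  simp only [h1, h5, Pi.star_apply, Pi.mul_apply, h2, h3, h4, star_mul']

/-- Pointwise conjugation, as a conjugate-linear map. -/
def starAE : ZakFun →ₗ⋆[ℂ] ZakFun where
  toFun F := star F
  map_add' := star_add_zakFun
  map_smul' := star_smul_zakFun

@[simp] lemma starAE_apply (F : ZakFun) : starAE F = star F := rfl

lemma star_mul_self_phase {u : ℝ × ℝ → ℝ} (hu : Continuous u) :
    star (AEEqFun.mk (fun w => phase (u w)) (continuous_phase.comp hu).aestronglyMeasurable :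
      ZakFun) * AEEqFun.mk (fun w => phase (u w)) (continuous_phase.comp hu).aestronglyMeasurable
      = 1 := by
  set β : ZakFun := AEEqFun.mk (fun w => phase (u w)) (continuous_phase.comp hu).aestronglyMeasurable
  refine AEEqFun.ext ?_
  filter_upwards [AEEqFun.coeFn_mul (star β) β, AEEqFun.coeFn_star β,
    AEEqFun.coeFn_mk (fun w => phase (u w))
      (continuous_phase.comp hu).aestronglyMeasurable (μ := volume.restrict Ω),
    AEEqFun.coeFn_one (α := ℝ × ℝ) (β := ℂ) (μ := volume.restrict Ω)] with w h1 h2 h3 h4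
  rw [h1, h4, Pi.mul_apply, h2, Pi.star_apply, h3, Pi.one_apply, ← phase_mul_neg (u w),
    ← conj_phase]; rfl

/-- `conj(Zψ) Zf`, for `f, ψ` translated by `ρ(-x,0,1)`. -/
def shiftPair (ψ f : H) (x : ℝ) : ZakFun :=
  star (zakAE (rhoOp (-x, 0) ψ)) * zakAE (rhoOp (-x, 0) f)

lemma star_zakAE_rhoOp_int_mul (k q : ℤ) (ψ f : H) :
    star (zakAE (rhoOp (k, q) ψ)) * zakAE (rhoOp (k, q) f) = star (zakAE ψ) * zakAE f := by
  have hu : Continuous fun w : ℝ × ℝ => (k * q / 2 + q * w.2 + k * w.1 : ℝ) := by fun_prop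
  have key : ∀ g : H, zakAE (rhoOp (k, q) g) = AEEqFun.mk
      (fun w : ℝ × ℝ => phase (k * q / 2 + q * w.2 + k * w.1))
      (continuous_phase.comp hu).aestronglyMeasurable * zakAE g := by
    intro g
    refine AEEqFun.ext ((zak_rhoOp_int k q g).trans ?_)
    filter_upwards [AEEqFun.coeFn_mul (AEEqFun.mk _
      (continuous_phase.comp hu).aestronglyMeasurable) (zakAE g),
      AEEqFun.coeFn_mk _ (continuous_phase.comp hu).aestronglyMeasurable
        (μ := volume.restrict Ω)] with w h1 h2
    refine Eq.trans ?_ h1.symm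
    rw [Pi.mul_apply, h2]; rfl
  rw [key, key, star_mul_zakFun, mul_mul_mul_comm, star_mul_self_phase hu, one_mul]

lemma rhoOp_comp (x y q : ℝ) (f : H) : rhoOp (x, 0) (rhoOp (y, q) f) =
    phase (y * q / 2 + q * x) • rhoOp (0, q) (rhoOp (x + y, 0) f) := by
  refine Lp.ext ?_
  filter_upwards [rhoOp_coeFn (x, 0) (rhoOp (y, q) f), ae_shift x (rhoOp_coeFn (y, q) f),
    Lp.coeFn_smul (phase (y * q / 2 + q * x)) (rhoOp (0, q) (rhoOp (x + y, 0) f)),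
    rhoOp_coeFn (0, q) (rhoOp (x + y, 0) f), ae_shift 0 (rhoOp_coeFn (x + y, 0) f)]
    with t h1 h2 h3 h4 h5
  rw [h1, h2, h3, Pi.smul_apply, h4, h5]
  simp only [mul_zero, zero_div, zero_mul, add_zero, zero_add, phase_zero, one_mul, smul_eq_mul]
  rw [← mul_assoc, ← phase_add]
  congr 2 <;> ring

lemma star_smul_mul_smul {c : ℂ} (hc : conj c * c = 1) (F G : ZakFun) :
    star (c • F) * (c • G) = star F * G := by
  rw [star_smul_zakFun, smul_mul_smul_comm, hc, one_smul]

lemma conj_phase_mul (t : ℝ) : conj (phase t) * phase t = 1 := by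
  rw [conj_phase, phase_mul_neg]

lemma shiftPair_rhoOp (y : ℝ) (q : ℤ) (ψ f : H) (x : ℝ) :
    shiftPair (rhoOp (y, q) ψ) (rhoOp (y, q) f) x = shiftPair ψ f (x - y) := by
  have h0 := star_zakAE_rhoOp_int_mul 0 q (rhoOp (-x + y, 0) ψ) (rhoOp (-x + y, 0) f)
  rw [Int.cast_zero] at h0
  have e : -(x - y) = -x + y := by ring
  rw [shiftPair, rhoOp_comp, rhoOp_comp, map_smul, map_smul,
    star_smul_mul_smul (conj_phase_mul _), h0, shiftPair, e]

lemma shiftPair_add_one (ψ f : H) (x : ℝ) : shiftPair ψ f (x + 1) = shiftPair ψ f x := by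
  have e : ∀ g : H, rhoOp (-(x + 1), 0) g = rhoOp (((-1 : ℤ) : ℝ), ((0 : ℤ) : ℝ))
      (rhoOp (-x, 0) g) := by
    intro g
    have h := rhoOp_comp (-1) (-x) 0 g
    have h1 : ((0, 0) : ℝ × ℝ) = 0 := rfl
    rw [h1, rhoOp_zero] at h
    simp only [mul_zero, zero_div, zero_mul, add_zero, phase_zero, one_smul,
      ContinuousLinearMap.id_apply] at h
    rw [Int.cast_neg, Int.cast_one, Int.cast_zero, h]
    congr 3; ring
  rw [shiftPair, e, e, star_zakAE_rhoOp_int_mul, shiftPair]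

lemma sum_range_add_of_periodic {M : Type*} [AddCommMonoid M] {a : ℕ} {u : ℤ → M}
    (hu : ∀ x, u (x + a) = u x) (m : ℤ) :
    ∑ j ∈ Finset.range a, u (j + m) = ∑ j ∈ Finset.range a, u j := by
  have step : ∀ m : ℤ, ∑ j ∈ Finset.range a, u (j + (m + 1)) = ∑ j ∈ Finset.range a, u (j + m) := by
    intro m
    cases a with
    | zero => simp
    | succ b =>
      rw [Finset.sum_range_succ, Finset.sum_range_succ' (fun j : ℕ => u (j + m))]
      congr 1
      · refine Finset.sum_congr rfl fun j _ => ?_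
        congr 1; push_cast; ring
      · rw [← hu ((0 : ℕ) + m)]; congr 1; push_cast; ring
  induction m using Int.induction_on with
  | zero => simp
  | succ i ih => rw [step, ih]
  | pred i ih => rw [← ih, ← step (-i - 1), sub_add_cancel]

lemma sum_shiftPair_sub {a : ℕ} (ha : 0 < a) (ψ f : H) (m : ℤ) :
    ∑ j ∈ Finset.range a, shiftPair ψ f ((j : ℝ) / a - m / a) =
      ∑ j ∈ Finset.range a, shiftPair ψ f ((j : ℝ) / a) := by
  have ha' : (a : ℝ) ≠ 0 := by exact_mod_cast ha.ne'
  have h := sum_range_add_of_periodic (u := fun x : ℤ => shiftPair ψ f ((x : ℝ) / a)) (a := a)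
    (fun x => by
      rw [← shiftPair_add_one ψ f ((x : ℝ) / a)]; congr 1; push_cast; field_simp) (-m)
  simp only [Int.cast_natCast] at h
  rw [← h]
  refine Finset.sum_congr rfl fun j _ => ?_
  congr 1; push_cast; ring

lemma phase_eq_one_iff {t : ℝ} : phase t = 1 ↔ ∃ n : ℤ, t = n := by
  constructor
  · intro h
    obtain ⟨n, hn⟩ := Complex.exp_eq_one_iff.1 h
    refine ⟨n, ?_⟩
    have h2 : (2 * Real.pi * Complex.I : ℂ) ≠ 0 := by simp [Real.pi_ne_zero]
    have h3 : (t : ℂ) = n := by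
      apply mul_left_cancel₀ h2; rw [hn]; ring
    exact_mod_cast h3
  · rintro ⟨n, rfl⟩; exact phase_intCast n

lemma exists_of_mem_dualLattice {a : ℕ} (ha : 0 < a) {w : ℝ × ℝ} (hw : w ∈ dualLattice a) :
    ∃ m q : ℤ, w = ((m : ℝ) / a, (q : ℝ)) := by
  have ha' : (a : ℝ) ≠ 0 := by exact_mod_cast ha.ne'
  have h1 := hw (((1 : ℤ) : ℝ), (a : ℝ) * (0 : ℤ)) ⟨1, 0, rfl⟩
  have h2 := hw (((0 : ℤ) : ℝ), (a : ℝ) * (-1 : ℤ)) ⟨0, -1, rfl⟩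
  obtain ⟨q, hq⟩ := phase_eq_one_iff.1 h1
  obtain ⟨m, hm⟩ := phase_eq_one_iff.1 h2
  push_cast at hq hm
  refine ⟨m, q, Prod.ext ?_ ?_⟩
  · simp only; rw [eq_div_iff ha', ← hm]; ring
  · simp only; rw [← hq]; ring

/-- The symbol of the periodization of `φ ⊗ ψ̄`. -/
def rankOneSymbol (a : ℕ) (φ ψ : H) (j : ℕ) : ZakFun :=
  zakAE φ * star (zakAE (rhoOp (-(j : ℝ) / a, 0) ψ))

lemma symMap_rankOneSymbol (a : ℕ) (φ ψ f : H) : symMap a (rankOneSymbol a φ ψ) f =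
    zakAE φ * ∑ j ∈ Finset.range a, shiftPair ψ f ((j : ℝ) / a) := by
  simp only [symMap_apply, rankOneSymbol, shiftPair, Finset.mul_sum, neg_div, mul_assoc]

lemma symMap_rankOneSymbol_rhoOp {a : ℕ} (ha : 0 < a) {w : ℝ × ℝ} (hw : w ∈ dualLattice a)
    (φ ψ f : H) : symMap a (rankOneSymbol a φ (rhoOp w ψ)) (rhoOp w f) =
      symMap a (rankOneSymbol a φ ψ) f := by
  obtain ⟨m, q, rfl⟩ := exists_of_mem_dualLattice ha hw
  simp only [symMap_rankOneSymbol, shiftPair_rhoOp, sum_shiftPair_sub ha]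

lemma zakExt_of_mem (f : H) {w : ℝ × ℝ} (hw : w ∈ Ω) : zakExt f w = zak f w := by
  rw [zakExt, Int.floor_eq_zero_iff.2 hw.2, Int.fract_eq_self.2 hw.1, Int.fract_eq_self.2 hw.2]
  simp

lemma zakExt_shift {a j : ℕ} (hj : j < a) (f : H) :
    (fun w : ℝ × ℝ => zakExt f (w.1, w.2 - (j : ℝ) / a)) =ᵐ[volume.restrict Ω]
      zakAE (rhoOp (-(j : ℝ) / a, 0) f) := by
  rw [zakAE_rhoOp_shift hj]
  filter_upwards [shiftAE_coeFn ((j : ℝ) / a) (zakAE f), ae_mem_Ω] with w h1 hw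
  rw [h1, zakExt]
  simp only [Int.fract_eq_self.2 hw.1, torusShift]
  rfl

lemma measurable_zakExt (f : H) : Measurable (zakExt f) := by
  have h1 := (measurable_shiftPhase 0)
  simp only [sub_zero] at h1
  refine h1.mul ((Lp.stronglyMeasurable (zak f)).measurable.comp ?_)
  exact (measurable_fract.comp measurable_fst).prodMk (measurable_fract.comp measurable_snd)

lemma measurable_zakExt_shift (f : H) (s : ℝ) :
    Measurable fun w : ℝ × ℝ => zakExt f (w.1, w.2 - s) :=
  (measurable_zakExt f).comp (measurable_fst.prodMk (measurable_snd.sub_const s))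

lemma norm_zakExt_sub_int (f : H) (x y : ℝ) (n : ℤ) :
    ‖zakExt f (x, y - n)‖ = ‖zakExt f (x, y)‖ := by
  simp only [zakExt, norm_mul, norm_phase, Int.fract_sub_intCast]

/-- The shift-invariant size `∑_{h<a} |Zf(θ, σ - h/a)|`. -/
def zakSize (a : ℕ) (f : H) (w : ℝ × ℝ) : ℝ :=
  ∑ h ∈ Finset.range a, ‖zakExt f (w.1, w.2 - (h : ℝ) / a)‖

lemma zakSize_nonneg (a : ℕ) (f : H) (w : ℝ × ℝ) : 0 ≤ zakSize a f w :=
  Finset.sum_nonneg fun _ _ => norm_nonneg _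

lemma norm_zakExt_le_zakSize {a j : ℕ} (hj : j < a) (f : H) (w : ℝ × ℝ) :
    ‖zakExt f (w.1, w.2 - (j : ℝ) / a)‖ ≤ zakSize a f w :=
  Finset.single_le_sum (f := fun h : ℕ => ‖zakExt f (w.1, w.2 - (h : ℝ) / a)‖)
    (fun _ _ => norm_nonneg _) (Finset.mem_range.2 hj)

lemma measurable_zakSize (a : ℕ) (f : H) : Measurable (zakSize a f) :=
  Finset.measurable_sum _ fun _ _ => (measurable_zakExt_shift f _).norm

lemma isShiftInvariant_zakSize (a : ℕ) (f : H) : IsShiftInvariant a (zakSize a f) := by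
  intro j hj w _
  have ha' : (a : ℝ) ≠ 0 := by
    have : a ≠ 0 := by omega
    exact_mod_cast this
  have h := sum_range_add_of_periodic (a := a)
    (u := fun x : ℤ => ‖zakExt f (w.1, w.2 - (x : ℝ) / a)‖) (fun x => by
      rw [← norm_zakExt_sub_int f w.1 (w.2 - (x : ℝ) / a) 1]
      congr 3; push_cast; field_simp; ring) j
  simp only [Int.cast_natCast] at h
  rw [zakSize, zakSize, ← h]
  refine Finset.sum_congr rfl fun i _ => ?_
  have e : (torusShift ((j : ℝ) / a) w).2 - (i : ℝ) / a =
      w.2 - (((i : ℤ) + (j : ℤ) : ℤ) : ℝ) / a - ⌊w.2 - (j : ℝ) / a⌋ := by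
    simp only [torusShift, Int.fract]
    push_cast
    ring
  rw [e]
  exact norm_zakExt_sub_int f w.1 _ _

lemma memLp_zakSize (a : ℕ) (f : H) : MemLp (zakSize a f) 2 (volume.restrict Ω) := by
  refine memLp_finsetSum _ fun h hh => ?_
  refine MemLp.norm ((memLp_congr_ae (zakExt_shift (Finset.mem_range.1 hh) f)).2 ?_)
  exact Lp.memLp (zak (rhoOp (-(h : ℝ) / a, 0) f))

lemma measurable_gFun (a j : ℕ) (φ ψ : H) : Measurable (gFun a j φ ψ) :=
  (measurable_zakExt φ).mul (Complex.continuous_conj.measurable.comp (measurable_zakExt_shift ψ _))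

lemma mk_gFun {a j : ℕ} (hj : j < a) (φ ψ : H) :
    AEEqFun.mk (gFun a j φ ψ) (measurable_gFun a j φ ψ).aestronglyMeasurable =
      rankOneSymbol a φ ψ j := by
  refine AEEqFun.ext ((AEEqFun.coeFn_mk _ _).trans ?_)
  filter_upwards [AEEqFun.coeFn_mul (zakAE φ) (star (zakAE (rhoOp (-(j : ℝ) / a, 0) ψ))),
    AEEqFun.coeFn_star (zakAE (rhoOp (-(j : ℝ) / a, 0) ψ)), zakExt_shift hj ψ, ae_mem_Ω]
    with w h1 h2 h3 hw
  rw [rankOneSymbol, h1, Pi.mul_apply, h2, Pi.star_apply, ← h3, gFun, zakExt_of_mem φ hw]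
  rfl

lemma norm_rankOneSymbol_le {a j : ℕ} (hj : j < a) (φ ψ : H) :
    ∀ᵐ w ∂(volume.restrict Ω : Measure (ℝ × ℝ)),
      ‖rankOneSymbol a φ ψ j w‖ ≤ zakSize a φ w * zakSize a ψ w := by
  rw [← mk_gFun hj]
  filter_upwards [AEEqFun.coeFn_mk (gFun a j φ ψ) (measurable_gFun a j φ ψ).aestronglyMeasurable
    (μ := volume.restrict Ω)] with w h1
  rw [h1, gFun, norm_mul, RCLike.norm_conj]
  have h2 := norm_zakExt_le_zakSize ((Nat.zero_le j).trans_lt hj) φ w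
  simp only [Nat.cast_zero, zero_div, sub_zero] at h2
  exact mul_le_mul h2 (norm_zakExt_le_zakSize hj ψ w) (norm_nonneg _) (zakSize_nonneg _ _ _)

lemma isShiftInvariant_zakSize_mul (a : ℕ) (φ ψ : H) :
    IsShiftInvariant a fun w => zakSize a φ w * zakSize a ψ w := fun j hj w hw => by
  simp only [isShiftInvariant_zakSize a φ j hj w hw, isShiftInvariant_zakSize a ψ j hj w hw]

lemma isDominated_rankOneSymbol (a : ℕ) (φ ψ : H) :
    IsDominated a (fun w => zakSize a φ w * zakSize a ψ w) (rankOneSymbol a φ ψ) where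
  meas := (measurable_zakSize a φ).mul (measurable_zakSize a ψ)
  inv := isShiftInvariant_zakSize_mul a φ ψ
  le _ hj := norm_rankOneSymbol_le hj φ ψ

lemma symMap_congr {a : ℕ} {G G' : ℕ → ZakFun} (h : ∀ j < a, G j = G' j) :
    symMap a G = symMap a G' := by
  ext1 f
  rw [symMap_apply, symMap_apply]
  exact Finset.sum_congr rfl fun j hj => by rw [h j (Finset.mem_range.1 hj)]

lemma compRight_mulZak_gFun {a : ℕ} (j : Fin a) (φ ψ : H) :
    compRight (mulZak (gFun a j φ ψ)) (rhoOp (-((j : ℕ) : ℝ) / a, 0)) =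
      zakOp (symMap a (Pi.single (j : ℕ) (rankOneSymbol a φ ψ j))) := by
  rw [mulZak_eq_zakOp (measurable_gFun a j φ ψ).aestronglyMeasurable, compRight_zakOp,
    mk_gFun j.2]
  congr 1
  ext1 f
  rw [symMap_apply, Finset.sum_eq_single_of_mem (j : ℕ) (Finset.mem_range.2 j.2), Pi.single_eq_same]
  · rfl
  · intro i _ hi
    rw [Pi.single_eq_of_ne hi, zero_mul]

lemma periodizationRankOne_eq (a : ℕ) (φ ψ : H) :
    periodizationRankOne a φ ψ = zakOp (symMap a (rankOneSymbol a φ ψ)) := by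
  have hd := isDominated_rankOneSymbol a φ ψ
  have hsum : ∀ i < a, (∑ j : Fin a, Pi.single (j : ℕ) (rankOneSymbol a φ ψ j) : ℕ → ZakFun) i =
      rankOneSymbol a φ ψ i := by
    intro i hi
    rw [Finset.sum_apply, Finset.sum_eq_single_of_mem ⟨i, hi⟩ (Finset.mem_univ _),
      Pi.single_eq_same]
    intro j _ hj
    exact Pi.single_eq_of_ne (fun h => hj (Fin.ext h.symm)) _
  have hfun : (fun i => ∑ j : Fin a, (Pi.single (j : ℕ) (rankOneSymbol a φ ψ j) : ℕ → ZakFun) i) =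
      (∑ j : Fin a, Pi.single (j : ℕ) (rankOneSymbol a φ ψ j) : ℕ → ZakFun) := by
    funext i; rw [Finset.sum_apply]
  have key := strongSum_zakOp (a := a) (c := fun w => zakSize a φ w * zakSize a ψ w)
    (G := fun j : Fin a => Pi.single (j : ℕ) (rankOneSymbol a φ ψ j)) (fun j =>
      { meas := hd.meas
        inv := hd.inv
        le := fun i hi => by
          rcases eq_or_ne i (j : ℕ) with rfl | hij
          · rw [Pi.single_eq_same]; exact hd.le _ hi
          · rw [Pi.single_eq_of_ne hij]
            filter_upwards [AEEqFun.coeFn_zero (α := ℝ × ℝ) (β := ℂ) (μ := volume.restrict Ω)]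
              with w hw
            rw [hw, Pi.zero_apply, norm_zero]
            exact mul_nonneg (zakSize_nonneg _ _ _) (zakSize_nonneg _ _ _) })
    { meas := hd.meas
      inv := hd.inv
      le := fun i hi => by
        have h := hsum i hi
        rw [Finset.sum_apply] at h
        rw [h]
        exact hd.le i hi }
  simp only [← compRight_mulZak_gFun] at key
  rw [periodizationRankOne, key, hfun, symMap_congr hsum]

/-- The symbol of the periodization of `∑_i φ_i ⊗ ψ̄_i`. -/
def finiteRankSymbol (a : ℕ) {n : ℕ} (φ ψ : Fin n → H) (j : ℕ) : ZakFun :=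
  ∑ i, rankOneSymbol a (φ i) (ψ i) j

/-- The weight `∑_i |Zφ_i| |Zψ_i|`, made shift-invariant. -/
def finiteRankWeight (a : ℕ) {n : ℕ} (φ ψ : Fin n → H) (w : ℝ × ℝ) : ℝ :=
  ∑ i, zakSize a (φ i) w * zakSize a (ψ i) w

lemma integrable_finiteRankWeight (a : ℕ) {n : ℕ} (φ ψ : Fin n → H) :
    Integrable (finiteRankWeight a φ ψ) (volume.restrict Ω) :=
  integrable_finsetSum _ fun i _ => (memLp_zakSize a (φ i)).integrable_mul (memLp_zakSize a (ψ i))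

lemma measurable_finiteRankWeight (a : ℕ) {n : ℕ} (φ ψ : Fin n → H) :
    Measurable (finiteRankWeight a φ ψ) :=
  Finset.measurable_sum _ fun i _ => (measurable_zakSize a (φ i)).mul (measurable_zakSize a (ψ i))

lemma isShiftInvariant_finiteRankWeight (a : ℕ) {n : ℕ} (φ ψ : Fin n → H) :
    IsShiftInvariant a (finiteRankWeight a φ ψ) := fun j hj w hw =>
  Finset.sum_congr rfl fun i _ => isShiftInvariant_zakSize_mul a (φ i) (ψ i) j hj w hw

lemma isDominated_summand (a : ℕ) {n : ℕ} (φ ψ : Fin n → H) (i : Fin n) :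
    IsDominated a (finiteRankWeight a φ ψ) (rankOneSymbol a (φ i) (ψ i)) where
  meas := measurable_finiteRankWeight a φ ψ
  inv := isShiftInvariant_finiteRankWeight a φ ψ
  le j hj := by
    filter_upwards [norm_rankOneSymbol_le hj (φ i) (ψ i)] with w hw
    exact hw.trans (Finset.single_le_sum (f := fun i => zakSize a (φ i) w * zakSize a (ψ i) w)
      (fun i _ => mul_nonneg (zakSize_nonneg _ _ _) (zakSize_nonneg _ _ _)) (Finset.mem_univ i))

lemma isDominated_finiteRankSymbol (a : ℕ) {n : ℕ} (φ ψ : Fin n → H) :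
    IsDominated a (finiteRankWeight a φ ψ) (finiteRankSymbol a φ ψ) where
  meas := measurable_finiteRankWeight a φ ψ
  inv := isShiftInvariant_finiteRankWeight a φ ψ
  le j hj := by
    filter_upwards [AEEqFun.coeFn_fun_finsetSum Finset.univ fun i =>
      rankOneSymbol a (φ i) (ψ i) j, ae_all_iff.2 fun i =>
        norm_rankOneSymbol_le hj (φ i) (ψ i)] with w h1 h2
    rw [finiteRankSymbol, h1]
    exact (norm_sum_le _ _).trans (Finset.sum_le_sum fun i _ => h2 i)

lemma strongSum_periodizationRankOne (a : ℕ) {n : ℕ} (φ ψ : Fin n → H) :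
    strongSum (fun i => periodizationRankOne a (φ i) (ψ i)) =
      zakOp (symMap a (finiteRankSymbol a φ ψ)) := by
  simp only [periodizationRankOne_eq]
  exact strongSum_zakOp (isDominated_summand a φ ψ) (isDominated_finiteRankSymbol a φ ψ)

/-- The symbol depends only on the finite rank operator. -/
lemma finiteRankSymbol_eq_sum (a : ℕ) {n d : ℕ} (φ ψ : Fin n → H) {S : Submodule ℂ H}
    (b : OrthonormalBasis (Fin d) ℂ S) (hψ : ∀ i, ψ i ∈ S) (j : ℕ) :
    finiteRankSymbol a φ ψ j =
      ∑ k, rankOneSymbol a ((∑ i, InnerProductSpace.rankOne ℂ (φ i) (ψ i)) (b k)) (b k) j := by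
  have hexp : ∀ i, ψ i = ∑ k, ⟪(b k : H), ψ i⟫_ℂ • (b k : H) := fun i => by
    have h := congrArg (fun x : S => (x : H)) (b.sum_repr' ⟨ψ i, hψ i⟩)
    simpa using h.symm
  have h1 : ∀ i, rankOneSymbol a (φ i) (ψ i) j =
      ∑ k, ⟪ψ i, (b k : H)⟫_ℂ • rankOneSymbol a (φ i) (b k) j := fun i => by
    rw [rankOneSymbol, ← starAE_apply]
    conv_lhs => rw [hexp i]
    simp only [map_sum, map_smul, map_smulₛₗ, Finset.mul_sum, mul_smul_comm, inner_conj_symm]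
    rfl
  rw [finiteRankSymbol, Finset.sum_congr rfl fun i _ => h1 i, Finset.sum_comm]
  refine Finset.sum_congr rfl fun k _ => ?_
  simp only [rankOneSymbol, sum_apply, map_sum, InnerProductSpace.rankOne_apply, map_smul,
    Finset.sum_mul, smul_mul_assoc]

lemma finiteRankSymbol_congr (a : ℕ) {n m : ℕ} {φ ψ : Fin n → H} {φ' ψ' : Fin m → H}
    (h : ∑ i, InnerProductSpace.rankOne ℂ (φ i) (ψ i) =
      ∑ i, InnerProductSpace.rankOne ℂ (φ' i) (ψ' i)) :
    finiteRankSymbol a φ ψ = finiteRankSymbol a φ' ψ' := by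
  let S : Submodule ℂ H := Submodule.span ℂ (range ψ ∪ range ψ')
  have : FiniteDimensional ℂ S :=
    FiniteDimensional.span_of_finite ℂ ((finite_range ψ).union (finite_range ψ'))
  let b := stdOrthonormalBasis ℂ S
  funext j
  rw [finiteRankSymbol_eq_sum a φ ψ b (fun i => Submodule.subset_span (Or.inl ⟨i, rfl⟩)) j,
    finiteRankSymbol_eq_sum a φ' ψ' b (fun i => Submodule.subset_span (Or.inr ⟨i, rfl⟩)) j, h]

lemma exists_sum_rankOne (X : H →L[ℂ] H)
    (hX : FiniteDimensional ℂ (LinearMap.range (X : H →ₗ[ℂ] H))) :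
    ∃ (n : ℕ) (φ ψ : Fin n → H), X = ∑ i, InnerProductSpace.rankOne ℂ (φ i) (ψ i) := by
  let e := stdOrthonormalBasis ℂ (LinearMap.range (X : H →ₗ[ℂ] H))
  refine ⟨_, fun k => e k, fun k => ContinuousLinearMap.adjoint X (e k), ?_⟩
  refine ContinuousLinearMap.ext fun f => ?_
  have h := congrArg (fun x : LinearMap.range (X : H →ₗ[ℂ] H) => (x : H))
    (e.sum_repr' ⟨X f, f, rfl⟩)
  simp only [sum_apply, InnerProductSpace.rankOne_apply, ContinuousLinearMap.adjoint_inner_left]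
  simpa using h.symm

lemma integral_finiteRankSymbol_zero (a : ℕ) {n : ℕ} (φ ψ : Fin n → H) :
    ∫ w in Ω, finiteRankSymbol a φ ψ 0 w = ∑ i, ⟪ψ i, φ i⟫_ℂ := by
  have h1 : ∀ i, ⟪ψ i, φ i⟫_ℂ = ∫ w in Ω, ⟪zak (ψ i) w, zak (φ i) w⟫_ℂ := fun i => by
    rw [← zak.inner_map_map, L2.inner_def]
  rw [Finset.sum_congr rfl fun i _ => h1 i,
    ← integral_finsetSum _ fun i _ => L2.integrable_inner _ _]
  refine integral_congr_ae ?_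
  have h2 : ∀ i, rankOneSymbol a (φ i) (ψ i) 0 = zakAE (φ i) * star (zakAE (ψ i)) := fun i => by
    have : ((-((0 : ℕ) : ℝ) / a, 0) : ℝ × ℝ) = 0 := by simp
    rw [rankOneSymbol, this, rhoOp_zero]; rfl
  filter_upwards [AEEqFun.coeFn_fun_finsetSum Finset.univ fun i =>
    rankOneSymbol a (φ i) (ψ i) 0, ae_all_iff.2 fun i =>
      AEEqFun.coeFn_mul (zakAE (φ i)) (star (zakAE (ψ i))), ae_all_iff.2 fun i =>
      AEEqFun.coeFn_star (zakAE (ψ i))] with w h3 h4 h5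
  rw [finiteRankSymbol, h3]
  refine Finset.sum_congr rfl fun i _ => ?_
  rw [h2, h4, Pi.mul_apply, h5, Pi.star_apply, zakAE_coeFn, zakAE_coeFn]
  rfl

lemma opTrace_sum_rankOne {n : ℕ} (φ ψ : Fin n → H) :
    opTrace (∑ i, InnerProductSpace.rankOne ℂ (φ i) (ψ i)) = ∑ i, ⟪ψ i, φ i⟫_ℂ := by
  refine HasSum.tsum_eq ?_
  simp only [sum_apply, InnerProductSpace.rankOne_apply, inner_sum, inner_smul_right]
  exact hasSum_sum fun i _ => onb.hasSum_inner_mul_inner (ψ i) (φ i)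

lemma adjoint_rhoOp (w : ℝ × ℝ) : ContinuousLinearMap.adjoint (rhoOp w) = rhoInv w :=
  (rho w.1 w.2 1).adjoint_eq_symm

lemma compRight_finiteRank {a : ℕ} (ha : 0 < a) {w : ℝ × ℝ} (hw : w ∈ dualLattice a) {n : ℕ}
    (φ ψ : Fin n → H) :
    compRight (zakOp (symMap a (finiteRankSymbol a φ ψ))) (ContinuousLinearMap.adjoint (rhoOp w)) =
      zakOp (symMap a (finiteRankSymbol a φ fun i => rhoOp w (ψ i))) := by
  rw [compRight_zakOp, adjoint_rhoOp]
  congr 1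
  ext1 f
  have hsum : ∀ ψ' : Fin n → H, symMap a (finiteRankSymbol a φ ψ') =
      ∑ i, symMap a (rankOneSymbol a (φ i) (ψ' i)) := fun ψ' =>
    symMap_sum a Finset.univ fun i => rankOneSymbol a (φ i) (ψ' i)
  rw [hsum, hsum, LinearMap.comp_apply, LinearMap.sum_apply, LinearMap.sum_apply]
  refine Finset.sum_congr rfl fun i _ => ?_
  conv_rhs => rw [← rhoOp_rhoInv w f]
  exact (symMap_rankOneSymbol_rhoOp ha hw (φ i) (ψ i) (rhoInv w f)).symm

lemma alpha_sum_rankOne {n : ℕ} (φ ψ : Fin n → H) (w : ℝ × ℝ) :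
    alpha (∑ i, InnerProductSpace.rankOne ℂ (φ i) (ψ i)) w = ∑ i, ⟪rhoOp w (ψ i), φ i⟫_ℂ := by
  rw [alpha, ContinuousLinearMap.finsetSum_comp]
  simp only [InnerProductSpace.rankOne_comp, ContinuousLinearMap.adjoint_adjoint]
  exact opTrace_sum_rankOne φ fun i => rhoOp w (ψ i)

end ZakPeriodization

end

theorem theorem4p6 (a : ℕ) (ha : 0 < a)
    (X : ZakPeriodization.H →L[ℂ] ZakPeriodization.H)
    (hX : FiniteDimensional ℂ (LinearMap.range (X : ZakPeriodization.H →ₗ[ℂ] ZakPeriodization.H))) :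
    ∃ T : ZakPeriodization.H →ₗ.[ℂ] ZakPeriodization.H,
      ZakPeriodization.IsPeriodization a X T ∧
      (∀ T', ZakPeriodization.IsPeriodization a X T' → T' = T) ∧
      ZakPeriodization.MemL1 a T ∧
      ∀ n' ∈ ZakPeriodization.dualLattice a,
        ZakPeriodization.HasFourierWignerCoeff a T n' (ZakPeriodization.alpha X n') := by
  obtain ⟨n, φ, ψ, rfl⟩ := ZakPeriodization.exists_sum_rankOne X hX
  refine ⟨_, ⟨n, φ, ψ, rfl, rfl⟩, ?_, ?_, fun n' hn' => ?_⟩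
  · rintro T' ⟨m, φ', ψ', h, rfl⟩
    rw [ZakPeriodization.strongSum_periodizationRankOne,
      ZakPeriodization.strongSum_periodizationRankOne,
      ZakPeriodization.finiteRankSymbol_congr a h]
  · rw [ZakPeriodization.strongSum_periodizationRankOne]
    exact (ZakPeriodization.isDominated_finiteRankSymbol a φ ψ).memL1 ha
      (ZakPeriodization.integrable_finiteRankWeight a φ ψ)
  · rw [ZakPeriodization.strongSum_periodizationRankOne, ZakPeriodization.HasFourierWignerCoeff,
      ZakPeriodization.compRight_finiteRank ha hn', ZakPeriodization.alpha_sum_rankOne,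
      ← ZakPeriodization.integral_finiteRankSymbol_zero a]
    exact (ZakPeriodization.isDominated_finiteRankSymbol a φ _).hasTau ha
      (ZakPeriodization.integrable_finiteRankWeight a φ _)
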